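/- Let $Q$ be a second-countable locally compact Hausdorff groupoid which is $r$-discrete, i.e. whose range map $r\colon Q\to Q^0$ onto the unit space is a local homeomorphism. Give $C_c(Q)$ the convolution product $(f*g)(x)=\sum_{r(y)=r(x)}f(y)\,g(y^{-1}x)$ and the involution $f^*(x)=\overline{f(x^{-1})}$, and let $C^*(Q)$ be its enveloping $C^*$-algebra, i.e. the completion of $C_c(Q)$ in its largest $C^*$-norm. Let $c\colon Q\to G$ be a continuous homomorphism into a discrete group $G$ with identity $e$, and let $N=c^{-1}(e)$, an open subgroupoid of $Q$, which is again locally compact, Hausdorff and $r$-discrete. Then the canonical $*$-homomorphism $i\colon C^*(N)\to C^*(Q)$ that extends the inclusion $C_c(N)\subseteq C_c(Q)$ (extension of functions by zero) is faithful, i.e. injective. -/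

import Mathlib

noncomputable section

open UniformSpace

section Enveloping

/-- A C⋆-seminorm on a complex ⋆-algebra: a submultiplicative seminorm `p` satisfying
`p (a⋆ a) = p a ^ 2`. -/
structure CStarSeminorm (A : Type*) [NonUnitalRing A] [Module ℂ A] [StarRing A] extends
    Seminorm ℂ A where
  mul_le' : ∀ a b : A, toFun (a * b) ≤ toFun a * toFun b
  star_mul_self' : ∀ a : A, toFun (star a * a) = toFun a ^ 2

namespace CStarSeminorm

variable {A : Type*} [NonUnitalRing A] [Module ℂ A] [StarRing A]

instance instCoeFun : CoeFun (CStarSeminorm A) fun _ => A → ℝ := ⟨fun p => p.toSeminorm⟩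

theorem mul_le (p : CStarSeminorm A) (a b : A) : p (a * b) ≤ p a * p b := p.mul_le' a b

theorem star_mul_self (p : CStarSeminorm A) (a : A) : p (star a * a) = p a ^ 2 :=
  p.star_mul_self' a

theorem nonneg (p : CStarSeminorm A) (a : A) : 0 ≤ p a := apply_nonneg p.toSeminorm a

theorem le_star (p : CStarSeminorm A) (a : A) : p a ≤ p (star a) := by
  have h := p.mul_le (star a) a
  rw [p.star_mul_self] at h
  by_contra! hc
  nlinarith [p.nonneg a, p.nonneg (star a)]

theorem map_star (p : CStarSeminorm A) (a : A) : p (star a) = p a :=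
  le_antisymm (by simpa using p.le_star (star a)) (p.le_star a)

/-- The zero C⋆-seminorm. -/
def zeroSeminorm : CStarSeminorm A where
  toSeminorm := 0
  mul_le' a b := by
    change (0 : Seminorm ℂ A) (a * b) ≤ (0 : Seminorm ℂ A) a * (0 : Seminorm ℂ A) b
    simp
  star_mul_self' a := by
    change (0 : Seminorm ℂ A) (star a * a) = (0 : Seminorm ℂ A) a ^ 2
    simp

instance instNonempty : Nonempty (CStarSeminorm A) := ⟨zeroSeminorm⟩

/-- The pullback of a C⋆-seminorm along a ⋆-homomorphism. -/
def comap {B : Type*} [NonUnitalRing B] [Module ℂ B] [StarRing B] (p : CStarSeminorm B)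
    (φ : A →⋆ₙₐ[ℂ] B) : CStarSeminorm A where
  toSeminorm := p.toSeminorm.comp (φ : A →ₗ[ℂ] B)
  mul_le' a b := by
    change p (φ (a * b)) ≤ p (φ a) * p (φ b)
    rw [map_mul]; exact p.mul_le _ _
  star_mul_self' a := by
    change p (φ (star a * a)) = p (φ a) ^ 2
    rw [map_mul, StarHomClass.map_star]; exact p.star_mul_self _

end CStarSeminorm

/-- The C⋆-inequality for a seminormed ⋆-ring. -/
class SeminormedCStarRing (E : Type*) [NonUnitalSeminormedRing E] [StarRing E] : Prop where
  norm_mul_self_le : ∀ a : E, ‖a‖ * ‖a‖ ≤ ‖star a * a‖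

namespace CStarSeminorm

variable {A : Type*} [NonUnitalRing A] [Module ℂ A] [StarRing A]

/-- The ⋆-algebra `A`, regarded as a seminormed algebra by means of `p`. -/
@[nolint unusedArguments]
def Carrier (_ : CStarSeminorm A) : Type _ := A

variable (p : CStarSeminorm A)

instance Carrier.instNonUnitalRing : NonUnitalRing p.Carrier := inferInstanceAs (NonUnitalRing A)
instance Carrier.instModule : Module ℂ p.Carrier := inferInstanceAs (Module ℂ A)
instance Carrier.instStarRing : StarRing p.Carrier := inferInstanceAs (StarRing A)
instance Carrier.instStarModule [StarModule ℂ A] : StarModule ℂ p.Carrier := inferInstanceAs (StarModule ℂ A)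
instance Carrier.instIsScalarTower [IsScalarTower ℂ A A] : IsScalarTower ℂ p.Carrier p.Carrier :=
  inferInstanceAs (IsScalarTower ℂ A A)
instance Carrier.instSMulCommClass [SMulCommClass ℂ A A] : SMulCommClass ℂ p.Carrier p.Carrier :=
  inferInstanceAs (SMulCommClass ℂ A A)

instance Carrier.instNonUnitalSeminormedRing : NonUnitalSeminormedRing p.Carrier where
  toNonUnitalRing := inferInstance
  toPseudoMetricSpace :=
    (AddGroupSeminorm.toSeminormedAddCommGroup (E := A) p.toAddGroupSeminorm).toPseudoMetricSpace
  norm := p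
  dist_eq _ _ := rfl
  norm_mul_le := p.mul_le

instance Carrier.instNormedSpace : NormedSpace ℂ p.Carrier where
  __ := (inferInstance : Module ℂ p.Carrier)
  norm_smul_le c a := (map_smul_eq_mul p.toSeminorm c a).le

theorem norm_def (a : A) : ‖(show p.Carrier from a)‖ = p a := rfl

instance Carrier.instSeminormedCStarRing : SeminormedCStarRing p.Carrier where
  norm_mul_self_le a := by
    exact ((p.star_mul_self a).trans (sq _)).ge

end CStarSeminorm

/-! The C⋆-algebra obtained by Hausdorff completion. -/
namespace CStarCompletion

section Ring

variable {E : Type*} [NonUnitalSeminormedRing E]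

instance instMul : Mul (Completion E) :=
  ⟨Function.curry <| (Completion.isDenseInducing_coe.prodMap
    Completion.isDenseInducing_coe).extend ((↑) ∘ Function.uncurry (· * ·))⟩

theorem coe_mul (a b : E) : ((a * b : E) : Completion E) = a * b :=
  ((Completion.isDenseInducing_coe.prodMap Completion.isDenseInducing_coe).extend_eq
      ((Completion.continuous_coe E).comp (@continuous_mul E _ _ _)) (a, b)).symm

instance instContinuousMul : ContinuousMul (Completion E) where
  continuous_mul := by
    let m := (AddMonoidHom.mul : E →+ E →+ E).compr₂ Completion.toCompl
    have : Continuous fun p : E × E => m p.1 p.2 :=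
      (Completion.continuous_coe E).comp continuous_mul
    have di : IsDenseInducing (Completion.toCompl : E → Completion E) :=
      Completion.isDenseInducing_coe
    exact (di.extend_Z_bilin di this :)

instance instNonUnitalNormedRing : NonUnitalNormedRing (Completion E) :=
  { (inferInstance : NormedAddCommGroup (Completion E)),
    (inferInstance : Mul (Completion E)) with
    zero_mul a :=
      Completion.induction_on a (isClosed_eq (by fun_prop) continuous_const)
        fun a => by rw [← Completion.coe_zero, ← coe_mul, zero_mul]
    mul_zero a :=
      Completion.induction_on a (isClosed_eq (by fun_prop) continuous_const)
        fun a ↦ by rw [← Completion.coe_zero, ← coe_mul, mul_zero]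
    mul_assoc a b c :=
      Completion.induction_on₃ a b c
        (isClosed_eq (by fun_prop) (by fun_prop))
        fun a b c => by rw [← coe_mul, ← coe_mul, ← coe_mul, ← coe_mul, mul_assoc]
    left_distrib a b c :=
      Completion.induction_on₃ a b c
        (isClosed_eq (by fun_prop) (by fun_prop))
        fun a b c => by
          rw [← Completion.coe_add, ← coe_mul, ← coe_mul, ← coe_mul, ← Completion.coe_add, mul_add]
    right_distrib a b c :=
      Completion.induction_on₃ a b c
        (isClosed_eq (by fun_prop) (by fun_prop))
        fun a b c => by
          rw [← Completion.coe_add, ← coe_mul, ← coe_mul, ← coe_mul, ← Completion.coe_add, add_mul]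
    norm_mul_le a b :=
      Completion.induction_on₂ a b
        (isClosed_le (by fun_prop) (by fun_prop))
        fun a b => by
          rw [← coe_mul, Completion.norm_coe, Completion.norm_coe, Completion.norm_coe]
          exact norm_mul_le a b }

end Ring

section Star

variable {E : Type*} [NonUnitalSeminormedRing E] [StarRing E]

theorem norm_star_eq [SeminormedCStarRing E] (a : E) : ‖star a‖ = ‖a‖ := by
  have key : ∀ b : E, ‖b‖ ≤ ‖star b‖ := fun b => by
    have h1 := SeminormedCStarRing.norm_mul_self_le b
    have h2 := norm_mul_le (star b) b
    by_contra! hc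
    nlinarith [norm_nonneg b, norm_nonneg (star b)]
  exact le_antisymm (by simpa using key (star a)) (key a)

theorem uniformContinuous_star [SeminormedCStarRing E] : UniformContinuous (star : E → E) :=
  (AddMonoidHomClass.isometry_of_norm (starAddEquiv : E ≃+ E) norm_star_eq).uniformContinuous

instance instStar : Star (Completion E) := ⟨Completion.map star⟩

theorem coe_star [SeminormedCStarRing E] (a : E) : ((star a : E) : Completion E) = star (a : Completion E) :=
  (Completion.map_coe uniformContinuous_star a).symm

theorem continuous_star' : Continuous (star : Completion E → Completion E) :=
  Completion.continuous_map

end Star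

variable {E : Type*} [NonUnitalSeminormedRing E] [NormedSpace ℂ E] [StarRing E]
  [SeminormedCStarRing E]

instance instStarRing : StarRing (Completion E) where
  star_involutive a := Completion.induction_on a
    (isClosed_eq (continuous_star'.comp continuous_star') continuous_id)
    fun a => by rw [← coe_star, ← coe_star, star_star]
  star_mul a b := Completion.induction_on₂ a b
    (isClosed_eq (continuous_star'.comp (by fun_prop))
      ((continuous_star'.comp continuous_snd).mul (continuous_star'.comp continuous_fst)))
    fun a b => by rw [← coe_mul, ← coe_star, ← coe_star, ← coe_star, ← coe_mul, star_mul]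
  star_add a b := Completion.induction_on₂ a b
    (isClosed_eq (continuous_star'.comp (by fun_prop))
      ((continuous_star'.comp continuous_fst).add (continuous_star'.comp continuous_snd)))
    fun a b => by
      rw [← Completion.coe_add, ← coe_star, ← coe_star, ← coe_star, ← Completion.coe_add, star_add]

instance instIsScalarTower [IsScalarTower ℂ E E] : IsScalarTower ℂ (Completion E) (Completion E) where
  smul_assoc c a b := Completion.induction_on₂ a b
    (isClosed_eq ((continuous_fst.const_smul c).mul continuous_snd)
      ((continuous_fst.mul continuous_snd).const_smul c))
    fun a b => by
      simp only [smul_eq_mul]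
      rw [← Completion.coe_smul, ← coe_mul, ← coe_mul, ← Completion.coe_smul, smul_mul_assoc]

instance instSMulCommClass [SMulCommClass ℂ E E] : SMulCommClass ℂ (Completion E) (Completion E) where
  smul_comm c a b := Completion.induction_on₂ a b
    (isClosed_eq ((continuous_fst.mul continuous_snd).const_smul c)
      (continuous_fst.mul (continuous_snd.const_smul c)))
    fun a b => by
      simp only [smul_eq_mul]
      rw [← Completion.coe_smul, ← coe_mul, ← coe_mul, ← Completion.coe_smul, mul_smul_comm]

instance instStarModule [StarModule ℂ E] : StarModule ℂ (Completion E) where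
  star_smul c a := Completion.induction_on a
    (isClosed_eq (continuous_star'.comp (continuous_id.const_smul c))
      ((continuous_star' (E := E)).const_smul (star c)))
    fun a => by
      rw [← Completion.coe_smul, ← coe_star, ← coe_star, ← Completion.coe_smul, star_smul]

instance instCStarRing : CStarRing (Completion E) where
  norm_mul_self_le a := Completion.induction_on a
    (isClosed_le (continuous_norm.mul continuous_norm)
      (((continuous_star' (E := E)).mul continuous_id).norm))
    fun a => by
      rw [← coe_star, ← coe_mul, Completion.norm_coe, Completion.norm_coe]
      exact SeminormedCStarRing.norm_mul_self_le a

instance instNonUnitalCStarAlgebra [IsScalarTower ℂ E E] [SMulCommClass ℂ E E] [StarModule ℂ E] :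
    NonUnitalCStarAlgebra (Completion E) where

end CStarCompletion

variable (A : Type*) [NonUnitalRing A] [Module ℂ A] [StarRing A]

/-- The ⋆-algebra `A` has a largest C⋆-seminorm, i.e. the supremum of all the C⋆-seminorms is finite
at every element. -/
class HasLargestCStarSeminorm : Prop where
  bddAbove : ∀ a : A, BddAbove (Set.range fun p : CStarSeminorm A => p a)

/-- The largest C⋆-seminorm on `A`: `‖a‖ = sup {p a | p a C⋆-seminorm on A}`. -/
def largestCStarSeminorm [H : HasLargestCStarSeminorm A] : CStarSeminorm A where
  toFun a := ⨆ p : CStarSeminorm A, p a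
  map_zero' := by simp
  add_le' a b := ciSup_le fun p => (map_add_le_add p.toSeminorm a b).trans
    (add_le_add (le_ciSup (H.bddAbove a) p) (le_ciSup (H.bddAbove b) p))
  neg' a := by simp
  smul' c a := by
    simp only [map_smul_eq_mul]
    exact (Real.mul_iSup_of_nonneg (norm_nonneg c) _).symm
  mul_le' a b := ciSup_le fun p => (p.mul_le a b).trans
    (mul_le_mul (le_ciSup (H.bddAbove a) p) (le_ciSup (H.bddAbove b) p) (p.nonneg b)
      ((p.nonneg a).trans (le_ciSup (H.bddAbove a) p)))
  star_mul_self' a := by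
    simp only [CStarSeminorm.star_mul_self]
    refine le_antisymm (ciSup_le fun p => ?_) ?_
    · exact pow_le_pow_left₀ (p.nonneg a) (le_ciSup (H.bddAbove a) p) 2
    · have hb : BddAbove (Set.range fun p : CStarSeminorm A => p a ^ 2) := by
        simpa only [CStarSeminorm.star_mul_self] using H.bddAbove (star a * a)
      have h : ⨆ p : CStarSeminorm A, p a ≤ √(⨆ p : CStarSeminorm A, p a ^ 2) :=
        ciSup_le fun p => Real.le_sqrt_of_sq_le (le_ciSup hb p)
      exact (pow_le_pow_left₀ (Real.iSup_nonneg fun p => p.nonneg a) h 2).trans_eq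
        (Real.sq_sqrt (Real.iSup_nonneg fun p => sq_nonneg _))

theorem le_largestCStarSeminorm [H : HasLargestCStarSeminorm A] (p : CStarSeminorm A) (a : A) :
    p a ≤ largestCStarSeminorm A a :=
  le_ciSup (H.bddAbove a) p

/-- The enveloping C⋆-algebra of `A`: the Hausdorff completion of `A` with respect to its largest
C⋆-seminorm. -/
abbrev EnvelopingCStarAlgebra [HasLargestCStarSeminorm A] : Type _ :=
  Completion (largestCStarSeminorm A).Carrier

end Enveloping

namespace CStarSeminorm

variable {A : Type*} [NonUnitalRing A] [Module ℂ A] [StarRing A]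

/-- The canonical ⋆-homomorphism of `A` into its completion with respect to a C⋆-seminorm. -/
def toCompletion (p : CStarSeminorm A) : A →⋆ₙₐ[ℂ] Completion p.Carrier where
  toFun a := ((show p.Carrier from a : p.Carrier) : Completion p.Carrier)
  map_smul' c a := Completion.coe_smul (X := p.Carrier) c a
  map_zero' := Completion.coe_zero
  map_add' a b := Completion.coe_add (α := p.Carrier) a b
  map_mul' a b := CStarCompletion.coe_mul (E := p.Carrier) a b
  map_star' a := CStarCompletion.coe_star (E := p.Carrier) a

theorem norm_toCompletion (p : CStarSeminorm A) (a : A) : ‖p.toCompletion a‖ = p a :=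
  Completion.norm_coe (E := p.Carrier) a

end CStarSeminorm

/-- The C⋆-seminorm `a ↦ ‖φ a‖` of a ⋆-homomorphism into a C⋆-algebra. -/
def CStarSeminorm.ofHom {A B : Type*} [NonUnitalRing A] [Module ℂ A] [StarRing A]
    [NonUnitalCStarAlgebra B] (φ : A →⋆ₙₐ[ℂ] B) : CStarSeminorm A where
  toSeminorm := (normSeminorm ℂ B).comp (φ : A →ₗ[ℂ] B)
  mul_le' a b := by
    change ‖φ (a * b)‖ ≤ ‖φ a‖ * ‖φ b‖
    rw [map_mul]; exact norm_mul_le _ _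
  star_mul_self' a := by
    change ‖φ (star a * a)‖ = ‖φ a‖ ^ 2
    rw [map_mul, StarHomClass.map_star, CStarRing.norm_star_mul_self, sq]

namespace EnvelopingCStarAlgebra

variable {A : Type*} [NonUnitalRing A] [Module ℂ A] [StarRing A] [HasLargestCStarSeminorm A]

/-- The canonical ⋆-homomorphism of `A` into its enveloping C⋆-algebra. -/
def of : A →⋆ₙₐ[ℂ] EnvelopingCStarAlgebra A :=
  (largestCStarSeminorm A).toCompletion

variable {B : Type*} [NonUnitalCStarAlgebra B]

theorem uniformContinuous_hom (φ : A →⋆ₙₐ[ℂ] B) :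
    UniformContinuous (fun a : (largestCStarSeminorm A).Carrier => φ a) := by
  refine AddMonoidHomClass.uniformContinuous_of_bound
    (show (largestCStarSeminorm A).Carrier →+ B from AddMonoidHomClass.toAddMonoidHom φ) 1 fun a => ?_
  rw [one_mul]
  exact le_largestCStarSeminorm A (CStarSeminorm.ofHom φ) a

/-- The extension by continuity of a ⋆-homomorphism `A → B` into a C⋆-algebra to the enveloping
C⋆-algebra of `A`. -/
def lift (φ : A →⋆ₙₐ[ℂ] B) : EnvelopingCStarAlgebra A →⋆ₙₐ[ℂ] B where
  toFun := Completion.extension fun a : (largestCStarSeminorm A).Carrier => φ a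
  map_smul' c a := Completion.induction_on a
    (isClosed_eq (Completion.continuous_extension.comp (continuous_id.const_smul c))
      (Completion.continuous_extension.const_smul c))
    fun a => by
      simp only [MonoidHom.id_apply]
      rw [← Completion.coe_smul, Completion.extension_coe (uniformContinuous_hom φ),
        Completion.extension_coe (uniformContinuous_hom φ)]
      exact map_smul φ c a
  map_zero' := by
    rw [← Completion.coe_zero, Completion.extension_coe (uniformContinuous_hom φ)]
    exact map_zero φ
  map_add' a b := Completion.induction_on₂ a b
    (isClosed_eq (Completion.continuous_extension.comp continuous_add)
      ((Completion.continuous_extension.comp continuous_fst).add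
        (Completion.continuous_extension.comp continuous_snd)))
    fun a b => by
      rw [← Completion.coe_add, Completion.extension_coe (uniformContinuous_hom φ),
        Completion.extension_coe (uniformContinuous_hom φ),
        Completion.extension_coe (uniformContinuous_hom φ)]
      exact map_add φ a b
  map_mul' a b := Completion.induction_on₂ a b
    (isClosed_eq (Completion.continuous_extension.comp continuous_mul)
      ((Completion.continuous_extension.comp continuous_fst).mul
        (Completion.continuous_extension.comp continuous_snd)))
    fun a b => by
      rw [← CStarCompletion.coe_mul, Completion.extension_coe (uniformContinuous_hom φ),
        Completion.extension_coe (uniformContinuous_hom φ),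
        Completion.extension_coe (uniformContinuous_hom φ)]
      exact map_mul φ a b
  map_star' a := Completion.induction_on a
    (isClosed_eq (Completion.continuous_extension.comp CStarCompletion.continuous_star')
      (continuous_star.comp Completion.continuous_extension))
    fun a => by
      rw [← CStarCompletion.coe_star, Completion.extension_coe (uniformContinuous_hom φ),
        Completion.extension_coe (uniformContinuous_hom φ)]
      exact StarHomClass.map_star φ a

theorem lift_of (φ : A →⋆ₙₐ[ℂ] B) (a : A) : lift φ (of a) = φ a :=
  Completion.extension_coe (uniformContinuous_hom φ) a

end EnvelopingCStarAlgebra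

end

noncomputable section

/-- A topological groupoid, given by its space of arrows `Q`. Units are arrows: the source and
range maps take values in the unit space `Q⁰ = {u | rng u = u}`, and `mul x y` is defined exactly
when `src x = rng y`. -/
class TopologicalGroupoid (Q : Type*) [TopologicalSpace Q] where
  src : Q → Q
  rng : Q → Q
  inv : Q → Q
  mul : ∀ x y : Q, src x = rng y → Q
  src_src : ∀ x, src (src x) = src x
  rng_src : ∀ x, rng (src x) = src x
  src_rng : ∀ x, src (rng x) = rng x
  rng_rng : ∀ x, rng (rng x) = rng x
  src_mul : ∀ x y h, src (mul x y h) = src y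
  rng_mul : ∀ x y h, rng (mul x y h) = rng x
  mul_assoc' : ∀ x y z (hxy : src x = rng y) (hyz : src y = rng z),
    mul (mul x y hxy) z ((src_mul x y hxy).trans hyz) =
      mul x (mul y z hyz) (hxy.trans (rng_mul y z hyz).symm)
  rng_mul_self : ∀ x, mul (rng x) x (src_rng x) = x
  mul_src_self : ∀ x, mul x (src x) (rng_src x).symm = x
  src_inv : ∀ x, src (inv x) = rng x
  rng_inv : ∀ x, rng (inv x) = src x
  inv_mul_self : ∀ x, mul (inv x) x (src_inv x) = src x
  mul_inv_self : ∀ x, mul x (inv x) (rng_inv x).symm = rng x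
  continuous_inv' : Continuous inv
  continuous_mul' : Continuous fun p : {p : Q × Q // src p.1 = rng p.2} => mul p.1.1 p.1.2 p.2

namespace TopologicalGroupoid

variable {Q : Type*} [TopologicalSpace Q] [TopologicalGroupoid Q]

theorem mul_congr {x x' y y' : Q} (hx : x = x') (hy : y = y') (h : src x = rng y)
    (h' : src x' = rng y') : mul x y h = mul x' y' h' := by
  subst hx; subst hy; rfl

theorem mul_eq_right' {u x : Q} (hu : rng u = u) (h : src u = rng x) : mul u x h = x := by
  have h1 : u = rng x := by rw [← h, ← hu, src_rng]
  subst h1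
  exact rng_mul_self x

theorem mul_eq_left' {x u : Q} (hu : rng u = u) (h : src x = rng u) : mul x u h = x := by
  have h1 : u = src x := by rw [h, hu]
  subst h1
  exact mul_src_self x

theorem inv_mul_cancel_left' (x y : Q) (h : src x = rng y)
    (h' : src (inv x) = rng (mul x y h)) : mul (inv x) (mul x y h) h' = y := by
  rw [← mul_assoc' (inv x) x y (src_inv x) h]
  rw [mul_congr (inv_mul_self x) rfl _ ((src_src x).trans h)]
  exact mul_eq_right' (rng_src x) _

theorem mul_inv_cancel_left' (x y : Q) (h : rng x = rng y) (h1 : src (inv x) = rng y)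
    (h2 : src x = rng (mul (inv x) y h1)) : mul x (mul (inv x) y h1) h2 = y := by
  rw [← mul_assoc' x (inv x) y (rng_inv x).symm h1]
  rw [mul_congr (mul_inv_self x) rfl _ ((src_rng x).trans h)]
  exact mul_eq_right' (rng_rng x) _

theorem mul_left_cancel' {x y y' : Q} (h : src x = rng y) (h' : src x = rng y')
    (e : mul x y h = mul x y' h') : y = y' := by
  rw [← inv_mul_cancel_left' x y h (by rw [src_inv, rng_mul]),
    ← inv_mul_cancel_left' x y' h' (by rw [src_inv, rng_mul])]
  exact mul_congr rfl e _ _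

theorem eq_inv_of_mul {x y : Q} (h : src x = rng y) (e : mul x y h = rng x) : y = inv x :=
  mul_left_cancel' h (rng_inv x).symm (e.trans (mul_inv_self x).symm)

theorem inv_inv' (x : Q) : inv (inv x) = x :=
  (eq_inv_of_mul (src_inv x) ((inv_mul_self x).trans (rng_inv x).symm)).symm

theorem inv_mul_rev' (x y : Q) (h : src x = rng y) :
    inv (mul x y h) = mul (inv y) (inv x) (by rw [src_inv, rng_inv, h]) := by
  refine (eq_inv_of_mul (by rw [src_mul, rng_mul, rng_inv]) ?_).symm
  rw [mul_assoc' x y _ h (by rw [rng_mul, rng_inv]),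
    mul_congr rfl (mul_inv_cancel_left' y (inv x) (by rw [rng_inv, h]) _ _) _ (rng_inv x).symm,
    mul_inv_self, rng_mul]

theorem inv_rng (x : Q) : inv (rng x) = rng x :=
  (eq_inv_of_mul (by rw [src_rng, rng_rng])
    ((mul_eq_right' (rng_rng x) _).trans (rng_rng x).symm)).symm

theorem continuous_src : Continuous (src : Q → Q) := by
  have : (src : Q → Q) = (fun p : {p : Q × Q // src p.1 = rng p.2} => mul p.1.1 p.1.2 p.2) ∘
      fun x => ⟨(inv x, x), src_inv x⟩ := funext fun x => (inv_mul_self x).symm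
  rw [this]
  exact continuous_mul'.comp ((continuous_inv'.prodMk continuous_id).subtype_mk _)

theorem continuous_rng : Continuous (rng : Q → Q) := by
  have : (rng : Q → Q) = src ∘ inv := funext fun x => (src_inv x).symm
  rw [this]
  exact continuous_src.comp continuous_inv'

variable (Q) in
/-- The unit space `Q⁰`. -/
def unitSpace : Set Q := {u | rng u = u}

variable (Q) in
/-- The range map `r : Q → Q⁰`. -/
def rangeMap (x : Q) : unitSpace Q := ⟨rng x, rng_rng x⟩

end TopologicalGroupoid

open TopologicalGroupoid

/-- A topological groupoid is r-discrete (étale) if its range map `r : Q → Q⁰` is a local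
homeomorphism. -/
class IsRDiscrete (Q : Type*) [TopologicalSpace Q] [TopologicalGroupoid Q] : Prop where
  isLocalHomeomorph_rangeMap : IsLocalHomeomorph (rangeMap Q)

namespace IsRDiscrete

variable {Q : Type*} [TopologicalSpace Q] [TopologicalGroupoid Q]

theorem isOpen_unitSpace [H : IsRDiscrete Q] : IsOpen (unitSpace Q) := by
  rw [isOpen_iff_mem_nhds]
  intro u hu
  obtain ⟨e, hue, he⟩ := H.isLocalHomeomorph_rangeMap u
  have hu' : rng u = u := hu
  have h1 : e.source ∈ nhds u := e.open_source.mem_nhds hue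
  have h2 : rng ⁻¹' e.source ∈ nhds u :=
    continuous_rng.continuousAt.preimage_mem_nhds (by rw [hu']; exact h1)
  filter_upwards [h1, h2] with x hx hrx
  refine e.injOn hrx hx ?_
  rw [← he]
  exact Subtype.ext (rng_rng x)

theorem isLocalHomeomorph_rng [H : IsRDiscrete Q] : IsLocalHomeomorph (rng : Q → Q) :=
  (isOpen_unitSpace (Q := Q)).isOpenEmbedding_subtypeVal.isLocalHomeomorph.comp
    H.isLocalHomeomorph_rangeMap

theorem of_isLocalHomeomorph_rng (h : IsLocalHomeomorph (rng : Q → Q)) : IsRDiscrete Q where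
  isLocalHomeomorph_rangeMap := by
    have ho : IsOpen (unitSpace Q) := by
      have : unitSpace Q = Set.range (rng : Q → Q) :=
        Set.Subset.antisymm (fun u hu => ⟨u, hu⟩) (by rintro _ ⟨x, rfl⟩; exact rng_rng x)
      rw [this]
      exact h.isOpenMap.isOpen_range
    exact IsLocalHomeomorph.of_comp (g := ((↑) : unitSpace Q → Q))
      h ho.isOpenEmbedding_subtypeVal.isLocalHomeomorph (continuous_rng.subtype_mk _)

end IsRDiscrete

/-- A continuous homomorphism from a topological groupoid to a topological group. -/
structure ContinuousGroupoidHom (Q G : Type*) [TopologicalSpace Q] [TopologicalGroupoid Q]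
    [Group G] [TopologicalSpace G] where
  toFun : Q → G
  map_mul' : ∀ (x y : Q) (h : src x = rng y), toFun (mul x y h) = toFun x * toFun y
  continuous_toFun : Continuous toFun

namespace ContinuousGroupoidHom

variable {Q G : Type*} [TopologicalSpace Q] [TopologicalGroupoid Q] [Group G] [TopologicalSpace G]

instance instCoeFun : CoeFun (ContinuousGroupoidHom Q G) fun _ => Q → G := ⟨toFun⟩

variable (c : ContinuousGroupoidHom Q G)

theorem map_rng (x : Q) : c (rng x) = 1 := by
  have h := c.map_mul' (rng x) x (src_rng x)
  rw [rng_mul_self] at h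
  exact right_eq_mul.1 h

theorem map_src (x : Q) : c (src x) = 1 := by
  rw [← rng_src, c.map_rng]

theorem map_inv (x : Q) : c (inv x) = (c x)⁻¹ := by
  have h := c.map_mul' (inv x) x (src_inv x)
  rw [inv_mul_self, map_src] at h
  exact eq_inv_of_mul_eq_one_left h.symm

/-- The kernel `N = c⁻¹(e)`. -/
def ker : Set Q := {q | c q = 1}

theorem inv_mem_ker {x : Q} (hx : x ∈ c.ker) : inv x ∈ c.ker := by
  change c (inv x) = 1
  rw [c.map_inv, show c x = 1 from hx, inv_one]

theorem mul_mem_ker {x y : Q} (h : src x = rng y) (hx : x ∈ c.ker) (hy : y ∈ c.ker) :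
    mul x y h ∈ c.ker := by
  change c (mul x y h) = 1
  rw [c.map_mul', show c x = 1 from hx, show c y = 1 from hy, one_mul]

theorem inv_mem_ker_iff {x : Q} : inv x ∈ c.ker ↔ x ∈ c.ker :=
  ⟨fun h => by simpa only [inv_inv'] using c.inv_mem_ker h, c.inv_mem_ker⟩

/-- The kernel is a topological groupoid, with the operations and the topology of `Q`. -/
instance instTopologicalGroupoidKer : TopologicalGroupoid c.ker where
  src x := ⟨src x.1, c.map_src x.1⟩
  rng x := ⟨rng x.1, c.map_rng x.1⟩
  inv x := ⟨inv x.1, c.inv_mem_ker x.2⟩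
  mul x y h := ⟨mul x.1 y.1 (congrArg Subtype.val h), c.mul_mem_ker _ x.2 y.2⟩
  src_src x := Subtype.ext (src_src x.1)
  rng_src x := Subtype.ext (rng_src x.1)
  src_rng x := Subtype.ext (src_rng x.1)
  rng_rng x := Subtype.ext (rng_rng x.1)
  src_mul x y h := Subtype.ext (src_mul x.1 y.1 _)
  rng_mul x y h := Subtype.ext (rng_mul x.1 y.1 _)
  mul_assoc' x y z h h' := Subtype.ext (mul_assoc' x.1 y.1 z.1 _ _)
  rng_mul_self x := Subtype.ext (rng_mul_self x.1)
  mul_src_self x := Subtype.ext (mul_src_self x.1)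
  src_inv x := Subtype.ext (src_inv x.1)
  rng_inv x := Subtype.ext (rng_inv x.1)
  inv_mul_self x := Subtype.ext (inv_mul_self x.1)
  mul_inv_self x := Subtype.ext (mul_inv_self x.1)
  continuous_inv' := (continuous_inv'.comp continuous_subtype_val).subtype_mk _
  continuous_mul' := by
    refine Continuous.subtype_mk ?_ _
    exact (continuous_mul' (Q := Q)).comp (f := fun p :
      {p : c.ker × c.ker // (⟨src p.1.1, c.map_src p.1.1⟩ : c.ker) = ⟨rng p.2.1, c.map_rng p.2.1⟩} =>
        (⟨(p.1.1.1, p.1.2.1), congrArg Subtype.val p.2⟩ : {p : Q × Q // src p.1 = rng p.2}))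
      (by fun_prop)

theorem coe_mul (x y : c.ker) (h : src x = rng y) :
    ((mul x y h : c.ker) : Q) = mul x.1 y.1 (congrArg Subtype.val h) := rfl

theorem isClopen_ker [DiscreteTopology G] : IsClopen c.ker :=
  (isClopen_discrete {(1 : G)}).preimage c.continuous_toFun

instance instIsRDiscreteKer [DiscreteTopology G] [IsRDiscrete Q] : IsRDiscrete c.ker := by
  have hi : IsLocalHomeomorph ((↑) : c.ker → Q) :=
    c.isClopen_ker.isOpen.isOpenEmbedding_subtypeVal.isLocalHomeomorph
  refine .of_isLocalHomeomorph_rng (IsLocalHomeomorph.of_comp ?_ hi continuous_rng)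
  exact IsRDiscrete.isLocalHomeomorph_rng.comp hi

instance instLocallyCompactSpaceKer [DiscreteTopology G] [LocallyCompactSpace Q] : LocallyCompactSpace c.ker :=
  c.isClopen_ker.isOpen.isOpenEmbedding_subtypeVal.locallyCompactSpace

end ContinuousGroupoidHom

end

noncomputable section

open TopologicalGroupoid CompactlySupported

/-- The space `C_c(Q)`, to be equipped with the convolution product and involution of the
r-discrete groupoid `Q`. -/
def ConvolutionAlgebra (Q : Type*) [TopologicalSpace Q] : Type _ := C_c(Q, ℂ)

namespace ConvolutionAlgebra

section Basic

variable {Q : Type*} [TopologicalSpace Q]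

instance instFunLike : FunLike (ConvolutionAlgebra Q) Q ℂ := inferInstanceAs (FunLike C_c(Q, ℂ) Q ℂ)
instance instAddCommGroup : AddCommGroup (ConvolutionAlgebra Q) := inferInstanceAs (AddCommGroup C_c(Q, ℂ))
instance instModule : Module ℂ (ConvolutionAlgebra Q) := inferInstanceAs (Module ℂ C_c(Q, ℂ))

/-- The element of `C_c(Q)` given by a continuous compactly supported function. -/
def mk (f : Q → ℂ) (hf : Continuous f) (hf' : HasCompactSupport f) : ConvolutionAlgebra Q :=
  (⟨⟨f, hf⟩, hf'⟩ : C_c(Q, ℂ))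

theorem mk_apply (f : Q → ℂ) (hf : Continuous f) (hf' : HasCompactSupport f) (x : Q) :
    mk f hf hf' x = f x := rfl

theorem continuous (f : ConvolutionAlgebra Q) : Continuous f :=
  (show C_c(Q, ℂ) from f).toContinuousMap.continuous

theorem hasCompactSupport (f : ConvolutionAlgebra Q) : HasCompactSupport f :=
  (show C_c(Q, ℂ) from f).hasCompactSupport'

theorem ext {f g : ConvolutionAlgebra Q} (h : ∀ x, f x = g x) : f = g := DFunLike.ext _ _ h

theorem add_apply (f g : ConvolutionAlgebra Q) (x : Q) : (f + g) x = f x + g x := rfl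
theorem neg_apply (f : ConvolutionAlgebra Q) (x : Q) : (-f) x = -f x := rfl
theorem smul_apply (z : ℂ) (f : ConvolutionAlgebra Q) (x : Q) : (z • f) x = z * f x := rfl
theorem zero_apply (x : Q) : (0 : ConvolutionAlgebra Q) x = 0 := rfl

theorem sum_apply {ι : Type*} (s : Finset ι) (f : ι → ConvolutionAlgebra Q) (x : Q) :
    (∑ i ∈ s, f i) x = ∑ i ∈ s, f i x :=
  CompactlySupportedContinuousMap.sum_apply (β := ℂ) s f x

end Basic

variable {Q : Type*} [TopologicalSpace Q] [TopologicalGroupoid Q]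

/-- The convolution product `(f * g)(x) = ∑_{r(y) = r(x)} f(y) g(y⁻¹x)`. For `f` in `C_c(Q)` only
finitely many summands are non-zero. -/
def conv (f g : Q → ℂ) (x : Q) : ℂ :=
  ∑ᶠ y : {y : Q // rng y = rng x}, f y * g (mul (inv y) x ((src_inv y.1).trans y.2))

section RDiscrete

variable [IsRDiscrete Q]

theorem finite_fibre [T2Space Q] {f : Q → ℂ} (hf : HasCompactSupport f) (u : Q) :
    {y : {y : Q // rng y = u} | f y ≠ 0}.Finite := by
  have hd : DiscreteTopology {y : Q | rng y = u} := by
    rw [discreteTopology_iff_isOpen_singleton]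
    rintro ⟨y, hy⟩
    obtain ⟨e, hye, he⟩ := IsRDiscrete.isLocalHomeomorph_rng (Q := Q) y
    suffices h : ({⟨y, hy⟩} : Set {y : Q | rng y = u}) = Subtype.val ⁻¹' e.source from
      h ▸ e.open_source.preimage continuous_subtype_val
    refine Set.ext ?_
    rintro ⟨z, hz⟩
    simp only [Set.mem_singleton_iff, Set.mem_preimage, Subtype.mk.injEq]
    refine ⟨fun h => h ▸ hye, fun h => e.injOn h hye ?_⟩
    rw [← he]
    exact hz.trans hy.symm
  have hc : IsClosed {y : Q | rng y = u} := isClosed_eq continuous_rng continuous_const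
  have hK := hc.isClosedEmbedding_subtypeVal.isCompact_preimage hf.isCompact
  exact (isCompact_iff_finite.1 hK).subset fun y hy => subset_tsupport f hy

variable [T2Space Q]

theorem hasFiniteSupport_conv {f : Q → ℂ} (hf : HasCompactSupport f) (g : Q → ℂ) (x : Q) :
    Function.HasFiniteSupport fun y : {y : Q // rng y = rng x} =>
      f y * g (mul (inv y) x ((src_inv y.1).trans y.2)) :=
  (finite_fibre hf (rng x)).subset fun _ hy => left_ne_zero_of_mul hy

theorem conv_add_left {f f' : Q → ℂ} (hf : HasCompactSupport f) (hf' : HasCompactSupport f')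
    (g : Q → ℂ) (x : Q) : conv (fun q => f q + f' q) g x = conv f g x + conv f' g x := by
  unfold conv
  rw [← finsum_add_distrib (hasFiniteSupport_conv hf g x) (hasFiniteSupport_conv hf' g x)]
  simp only [add_mul]

theorem conv_add_right {f : Q → ℂ} (hf : HasCompactSupport f) (g g' : Q → ℂ) (x : Q) :
    conv f (fun q => g q + g' q) x = conv f g x + conv f g' x := by
  unfold conv
  rw [← finsum_add_distrib (hasFiniteSupport_conv hf g x) (hasFiniteSupport_conv hf g' x)]
  simp only [mul_add]

end RDiscrete

theorem conv_smul_left (z : ℂ) (f g : Q → ℂ) (x : Q) :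
    conv (fun q => z * f q) g x = z * conv f g x := by
  unfold conv
  rw [mul_finsum]
  simp only [mul_assoc]

theorem conv_smul_right (z : ℂ) (f g : Q → ℂ) (x : Q) :
    conv f (fun q => z * g q) x = z * conv f g x := by
  unfold conv
  rw [mul_finsum]
  simp only [mul_left_comm]

theorem conv_eq_zero {f g : Q → ℂ} {x : Q}
    (h : ∀ y z hyz, f y ≠ 0 → g z ≠ 0 → mul y z hyz ≠ x) : conv f g x = 0 := by
  unfold conv
  rw [← finsum_zero (α := {y : Q // rng y = rng x})]
  refine finsum_congr fun y => ?_
  by_contra hne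
  exact h _ _ (by rw [rng_mul, rng_inv]) (left_ne_zero_of_mul hne) (right_ne_zero_of_mul hne)
    (mul_inv_cancel_left' y.1 x y.2 _ _)

theorem conv_congr_left {f f' : Q → ℂ} (h : ∀ q, f q = f' q) (g : Q → ℂ) :
    conv f g = conv f' g := by rw [funext h]

/-- Left translation `w ↦ z w` from the range fibre of `s(z)` onto that of `r(z)`. -/
def translate (z : Q) {u v : Q} (hz : rng z = u) (hz' : src z = v) :
    {w : Q // rng w = v} ≃ {y : Q // rng y = u} where
  toFun w := ⟨mul z w (hz'.trans w.2.symm), (rng_mul z w.1 _).trans hz⟩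
  invFun y := ⟨mul (inv z) y ((src_inv z).trans (hz.trans y.2.symm)),
    (rng_mul _ _ _).trans ((rng_inv z).trans hz')⟩
  left_inv w := Subtype.ext (inv_mul_cancel_left' z w.1 _ _)
  right_inv y := Subtype.ext (mul_inv_cancel_left' z y.1 (hz.trans y.2.symm) _ _)

theorem conv_assoc [IsRDiscrete Q] [T2Space Q] {f g : Q → ℂ} (hf : HasCompactSupport f)
    (hg : HasCompactSupport g) (h : Q → ℂ) (x : Q) :
    conv (conv f g) h x = conv f (conv g h) x := by
  set F : {y : Q // rng y = rng x} → {z : Q // rng z = rng x} → ℂ := fun y z =>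
    f z * g (mul (inv z) y ((src_inv z.1).trans (z.2.trans y.2.symm))) *
      h (mul (inv y) x ((src_inv y.1).trans y.2)) with hF
  have e1 : conv (conv f g) h x = ∑ᶠ y, ∑ᶠ z, F y z := by
    rw [conv]
    refine finsum_congr fun y => ?_
    rw [conv, finsum_mul]
    exact (finsum_comp_equiv (Equiv.subtypeEquivRight
      (p := fun z : Q => rng z = rng y.1) (q := fun z : Q => rng z = rng x)
      (fun z => by rw [y.2])) (f := F y))
  have e2 : conv f (conv g h) x = ∑ᶠ z, ∑ᶠ y, F y z := by
    rw [conv]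
    refine finsum_congr fun z => ?_
    rw [conv, mul_finsum, ← finsum_comp_equiv (translate z.1 z.2 rfl)]
    rw [← finsum_comp_equiv (Equiv.subtypeEquivRight
      (p := fun w : Q => rng w = src z.1) (q := fun w : Q => rng w = _)
      (fun w => by rw [rng_mul, rng_inv]))]
    refine finsum_congr fun w => ?_
    have h1 : mul (inv z.1) (mul z.1 w.1 w.2.symm) (by rw [src_inv, rng_mul]) = w.1 :=
      inv_mul_cancel_left' _ _ _ _
    have h2 : ∀ p q r, mul (inv (mul z.1 w.1 p)) x q = mul (inv w.1) (mul (inv z.1) x r)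
        (by rw [src_inv, w.2, rng_mul, rng_inv]) := fun p q r => by
      rw [← mul_assoc' _ _ _ (by rw [src_inv, rng_inv, w.2])]
      exact mul_congr (inv_mul_rev' _ _ _) rfl _ _
    simp only [hF, translate, Equiv.coe_fn_mk, Equiv.subtypeEquivRight_apply_coe, h1]
    rw [h2, mul_assoc]
  have hfin' : Function.HasFiniteSupport (Function.uncurry fun z y => F y z) := by
    refine ((finite_fibre hf (rng x)).biUnion (t := fun z => (fun y => (z, y)) ''
      (translate z.1 z.2 rfl '' {w : {w : Q // rng w = src z.1} | g w ≠ 0}))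
      fun z _ => ((finite_fibre hg (src z.1)).image _).image _).subset ?_
    rintro ⟨z, y⟩ hzy
    have hzy' : f z * g (mul (inv z) y ((src_inv z.1).trans (z.2.trans y.2.symm))) *
      h (mul (inv y) x ((src_inv y.1).trans y.2)) ≠ 0 := hzy
    have h1 := left_ne_zero_of_mul hzy'
    simp only [Set.mem_iUnion]
    refine ⟨z, left_ne_zero_of_mul h1, y, ⟨(translate z.1 z.2 rfl).symm y,
      right_ne_zero_of_mul h1, Equiv.apply_symm_apply _ _⟩, rfl⟩
  have hfin : Function.HasFiniteSupport (Function.uncurry F) := by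
    refine (hfin'.image Prod.swap).subset ?_
    rintro ⟨y, z⟩ hyz
    exact ⟨(z, y), hyz, rfl⟩
  rw [e1, e2]
  refine (finsum_curry (Function.uncurry F) hfin).symm.trans
    (Eq.trans ?_ (finsum_curry (Function.uncurry fun z y => F y z) hfin'))
  exact finsum_comp_equiv (Equiv.prodComm _ _)
    (f := Function.uncurry fun z y => F y z)

theorem star_conv (f g : Q → ℂ) (x : Q) :
    starRingEnd ℂ (conv f g (inv x)) =
      conv (fun q => starRingEnd ℂ (g (inv q))) (fun q => starRingEnd ℂ (f (inv q))) x := by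
  unfold conv
  have h0 : ∀ F : {y : Q // rng y = rng (inv x)} → ℂ,
      starRingEnd ℂ (∑ᶠ y, F y) = ∑ᶠ y, starRingEnd ℂ (F y) := fun F =>
    AddMonoidHom.map_finsum_of_injective (starRingEnd ℂ : ℂ →+ ℂ) (starRingEnd ℂ).injective F
  rw [h0, ← finsum_comp_equiv (translate (inv x) rfl (src_inv x))]
  refine finsum_congr fun w => ?_
  have h1 : ∀ p q, mul (inv (mul (inv x) w.1 p)) (inv x) q = inv w.1 := fun p q => by
    rw [← inv_mul_rev' x _ (by rw [rng_mul, rng_inv])]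
    rw [mul_inv_cancel_left' _ _ w.2.symm]
  have h2 : ∀ p, inv (mul (inv w.1) x p) = mul (inv x) w.1 ((src_inv x).trans w.2.symm) :=
    fun p => by
      rw [inv_mul_rev']
      exact mul_congr rfl (inv_inv' _) _ _
  simp only [translate, Equiv.coe_fn_mk, h1, h2, map_mul]
  exact mul_comm _ _

section RDiscrete

theorem hasCompactSupport_conv [T2Space Q] {f g : Q → ℂ} (hf : HasCompactSupport f)
    (hg : HasCompactSupport g) : HasCompactSupport (conv f g) := by
  have hc : IsClosed {p : Q × Q | src p.1 = rng p.2} :=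
    isClosed_eq (continuous_src.comp continuous_fst) (continuous_rng.comp continuous_snd)
  have hK := (hc.isClosedEmbedding_subtypeVal.isCompact_preimage
    (hf.isCompact.prod hg.isCompact)).image (continuous_mul' (Q := Q))
  refine HasCompactSupport.intro hK fun x hx => conv_eq_zero fun y z hyz hy hz hm => hx ?_
  exact ⟨⟨(y, z), hyz⟩, ⟨subset_tsupport f hy, subset_tsupport g hz⟩, hm⟩

theorem continuous_conv_aux [T2Space Q] (e : OpenPartialHomeomorph Q Q) (he : ∀ q, e q = rng q) {f g : Q → ℂ}
    (hf : Continuous f) (hf' : HasCompactSupport f) (hfe : tsupport f ⊆ e.source)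
    (hg : Continuous g) : Continuous (conv f g) := by
  have hr : ∀ {u}, u ∈ e.target → rng (e.symm u) = u := fun hu => by rw [← he, e.right_inv hu]
  rw [continuous_iff_continuousAt]
  intro x
  by_cases hx : rng x ∈ e.target
  · have hW : IsOpen {x : Q | rng x ∈ e.target} := e.open_target.preimage continuous_rng
    suffices h : ContinuousOn (conv f g) {x : Q | rng x ∈ e.target} from
      h.continuousAt (hW.mem_nhds hx)
    rw [continuousOn_iff_continuous_domRestrict]
    have hs : Continuous fun x : {x : Q | rng x ∈ e.target} => e.symm (rng x.1) :=
      e.continuousOn_symm.comp_continuous (continuous_rng.comp continuous_subtype_val)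
        fun x => x.2
    have key : Set.domRestrict {x : Q | rng x ∈ e.target} (conv f g) = fun x =>
        f (e.symm (rng x.1)) * g (mul (inv (e.symm (rng x.1))) x.1
          ((src_inv _).trans (hr x.2))) := by
      funext x
      rw [Set.domRestrict_apply, conv]
      refine (finsum_eq_single _ (⟨e.symm (rng x.1), hr x.2⟩ : {y : Q // rng y = rng x.1})
        fun y hy => ?_)
      by_contra hne
      have hys : y.1 ∈ e.source := hfe (subset_tsupport f (left_ne_zero_of_mul hne))
      refine hy (Subtype.ext ?_)
      change y.1 = e.symm (rng x.1)
      exact (e.left_inv hys).symm.trans (congrArg e.symm ((he y.1).trans y.2))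
    rw [key]
    refine (hf.comp hs).mul (hg.comp ?_)
    exact (continuous_mul' (Q := Q)).comp (f := fun x : {x : Q | rng x ∈ e.target} =>
      (⟨(inv (e.symm (rng x.1)), x.1), (src_inv _).trans (hr x.2)⟩ :
        {p : Q × Q // src p.1 = rng p.2}))
      (((continuous_inv'.comp hs).prodMk continuous_subtype_val).subtype_mk _)
  · have hV : IsOpen (rng ⁻¹' (rng '' tsupport f)ᶜ) :=
      ((hf'.isCompact.image continuous_rng).isClosed.isOpen_compl).preimage continuous_rng
    have hxV : x ∈ rng ⁻¹' (rng '' tsupport f)ᶜ := by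
      rintro ⟨y, hy, hyx⟩
      exact hx (hyx ▸ he y ▸ e.map_source (hfe hy))
    refine ContinuousAt.congr (f := fun _ => (0 : ℂ)) continuousAt_const ?_
    filter_upwards [hV.mem_nhds hxV] with z hz
    refine (conv_eq_zero fun y w hyw hy _ hm => hz ⟨y, subset_tsupport f hy, ?_⟩).symm
    rw [← hm, rng_mul]

variable [IsRDiscrete Q] [T2Space Q]

theorem conv_sum_left {n : ℕ} (F : Fin n → ConvolutionAlgebra Q) (g : Q → ℂ) (x : Q) :
    conv (∑ i, F i : ConvolutionAlgebra Q) g x = ∑ i, conv (F i) g x := by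
  unfold conv
  rw [← finsum_sum_comm Finset.univ _ fun i _ => hasFiniteSupport_conv (F i).hasCompactSupport g x]
  simp only [sum_apply, Finset.sum_mul]

variable [LocallyCompactSpace Q]

/-- Every element of `C_c(Q)` is a finite sum of functions supported in open sets on which the range
map is a homeomorphism. -/
theorem exists_sum_eq (f : ConvolutionAlgebra Q) :
    ∃ (n : ℕ) (F : Fin n → ConvolutionAlgebra Q), f = ∑ i, F i ∧
      ∀ i, ∃ e : OpenPartialHomeomorph Q Q, (∀ q, e q = rng q) ∧ tsupport (F i) ⊆ e.source := by
  choose e hxe he using IsRDiscrete.isLocalHomeomorph_rng (Q := Q)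
  obtain ⟨t, ht⟩ := f.hasCompactSupport.isCompact.elim_finite_subcover (fun x => (e x).source)
    (fun x => (e x).open_source) fun x _ => Set.mem_iUnion.2 ⟨x, hxe x⟩
  let ι := t.equivFin.symm
  obtain ⟨φ, hφ1, hφ2, -, -⟩ := exists_continuous_sum_one_of_isOpen_isCompact
    (s := fun i => (e (ι i).1).source) (fun i => (e (ι i).1).open_source)
    f.hasCompactSupport.isCompact (by
      refine ht.trans fun x hx => ?_
      simp only [Set.mem_iUnion] at hx ⊢
      obtain ⟨y, hy, hxy⟩ := hx
      exact ⟨t.equivFin ⟨y, hy⟩, by simpa [ι] using hxy⟩)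
  refine ⟨_, fun i => mk (fun x => (φ i x : ℂ) * f x)
    ((Complex.continuous_ofReal.comp (φ i).continuous).mul f.continuous)
    (f.hasCompactSupport.mul_left), ext fun x => ?_, fun i => ⟨e (ι i).1, fun q => ?_, ?_⟩⟩
  · rw [sum_apply]
    simp only [mk_apply]
    rw [← Finset.sum_mul]
    by_cases hx : x ∈ tsupport f
    · have := hφ2 hx
      simp only [Finset.sum_apply, Pi.one_apply] at this
      rw [← Complex.ofReal_sum, this, Complex.ofReal_one, one_mul]
    · rw [image_eq_zero_of_notMem_tsupport hx, mul_zero]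
  · rw [← he]
  · refine (closure_mono fun x hx => ?_).trans (hφ1 i)
    intro h0
    exact hx (by simp [mk_apply, h0])

theorem continuous_conv (f g : ConvolutionAlgebra Q) : Continuous (conv f g) := by
  obtain ⟨n, F, rfl, hF⟩ := exists_sum_eq f
  rw [show conv (∑ i, F i : ConvolutionAlgebra Q) g = fun x => ∑ i, conv (F i) g x from
    funext fun x => conv_sum_left F g x]
  refine continuous_finsetSum _ fun i _ => ?_
  obtain ⟨e, he, hs⟩ := hF i
  exact continuous_conv_aux e he (F i).continuous (F i).hasCompactSupport hs g.continuous

instance instMul : Mul (ConvolutionAlgebra Q) where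
  mul f g := mk (conv f g) (continuous_conv f g)
    (hasCompactSupport_conv f.hasCompactSupport g.hasCompactSupport)

theorem mul_apply (f g : ConvolutionAlgebra Q) (x : Q) : (f * g) x = conv f g x := rfl

end RDiscrete

/-- The involution `f⋆(x) = conj (f (x⁻¹))`. -/
instance instStar : Star (ConvolutionAlgebra Q) where
  star f := mk (fun x => starRingEnd ℂ (f (inv x)))
    (Complex.continuous_conj.comp (f.continuous.comp continuous_inv'))
    ((f.hasCompactSupport.comp_homeomorph
      { toFun := inv
        invFun := inv
        left_inv := inv_inv'
        right_inv := inv_inv'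
        continuous_toFun := continuous_inv'
        continuous_invFun := continuous_inv' }).comp_left (map_zero (starRingEnd ℂ)))

theorem star_apply (f : ConvolutionAlgebra Q) (x : Q) : (star f) x = starRingEnd ℂ (f (inv x)) :=
  rfl

theorem conv_of_unit {f : Q → ℂ} (hf : ∀ q, f q ≠ 0 → rng q = q) (g : Q → ℂ) (x : Q) :
    conv f g x = f (rng x) * g x := by
  rw [conv, finsum_eq_single _ (⟨rng x, rng_rng x⟩ : {y : Q // rng y = rng x})]
  · congr 2
    exact mul_eq_right' (by rw [rng_inv, src_rng, inv_rng]) _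
  · rintro ⟨y, hy⟩ hne
    by_contra h
    exact hne (Subtype.ext ((hf y (left_ne_zero_of_mul h)).symm.trans hy))

section Algebra

variable [IsRDiscrete Q] [T2Space Q] [LocallyCompactSpace Q]

instance instNonUnitalRing : NonUnitalRing (ConvolutionAlgebra Q) where
  left_distrib f g h := ext fun x => conv_add_right f.hasCompactSupport g h x
  right_distrib f g h := ext fun x =>
    conv_add_left f.hasCompactSupport g.hasCompactSupport h x
  zero_mul _ := ext fun _ => conv_eq_zero fun _ _ _ hy => absurd rfl hy
  mul_zero _ := ext fun _ => conv_eq_zero fun _ _ _ _ hz => absurd rfl hz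
  mul_assoc f g h := ext fun x => conv_assoc f.hasCompactSupport g.hasCompactSupport h x

instance instIsScalarTower : IsScalarTower ℂ (ConvolutionAlgebra Q) (ConvolutionAlgebra Q) where
  smul_assoc z f g := ext fun x => conv_smul_left z f g x

instance instSMulCommClass : SMulCommClass ℂ (ConvolutionAlgebra Q) (ConvolutionAlgebra Q) where
  smul_comm z f g := ext fun x => (conv_smul_right z f g x).symm

instance instStarRing : StarRing (ConvolutionAlgebra Q) where
  star_involutive f := ext fun x => by rw [star_apply, star_apply, inv_inv', Complex.conj_conj]
  star_mul f g := ext fun x => star_conv f g x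
  star_add _ _ := ext fun _ => map_add (starRingEnd ℂ) _ _

instance instStarModule : StarModule ℂ (ConvolutionAlgebra Q) where
  star_smul _ _ := ext fun _ => map_mul (starRingEnd ℂ) _ _

/-- An element supported in the unit space with values of modulus at most `M` has quasispectrum in
the disc of radius `M`. -/
theorem norm_le_of_mem_quasispectrum {b : ConvolutionAlgebra Q} (hb : ∀ q, b q ≠ 0 → rng q = q)
    {M : ℝ} (hM : ∀ q, ‖b q‖ ≤ M) {z : ℂ} (hz : z ∈ quasispectrum ℂ b) : ‖z‖ ≤ M ∨ z = 0 := by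
  by_contra! hc
  obtain ⟨hc, h0⟩ := hc
  refine hz (isUnit_iff_ne_zero.2 h0) ?_
  have hne : ∀ q, z - b q ≠ 0 := fun q h => by
    have := hM q
    rw [← sub_eq_zero.1 h] at this
    exact this.not_gt hc
  let y : ConvolutionAlgebra Q := mk (fun q => b q * (z - b q)⁻¹)
    (b.continuous.mul ((continuous_const.sub b.continuous).inv₀ hne)) b.hasCompactSupport.mul_right
  have hy : ∀ q, y q ≠ 0 → rng q = q := fun q hq => hb q (left_ne_zero_of_mul hq)
  have hw : ((isUnit_iff_ne_zero.2 h0).unit⁻¹ • b : ConvolutionAlgebra Q) = z⁻¹ • b := by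
    rw [Units.smul_def]; simp
  rw [hw, isQuasiregular_iff]
  have hx : ∀ q, (-(z⁻¹ • b)) q ≠ 0 → rng q = q := fun q hq => hb q (by
    rw [neg_apply, smul_apply] at hq
    exact right_ne_zero_of_mul (neg_ne_zero.1 hq))
  refine ⟨y, ext fun q => ?_, ext fun q => ?_⟩
  · rw [add_apply, add_apply, mul_apply, conv_of_unit hx, zero_apply]
    by_cases hq : rng q = q
    · rw [hq]
      simp only [neg_apply, smul_apply, y, mk_apply]
      field_simp [hne q]
      ring
    · have h1 : b q = 0 := by by_contra h; exact hq (hb q h)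
      have h2 : y q = 0 := by by_contra h; exact hq (hy q h)
      rw [neg_apply, smul_apply, h1, h2]; simp
  · rw [add_apply, add_apply, mul_apply, conv_of_unit hy, zero_apply]
    by_cases hq : rng q = q
    · rw [hq]
      simp only [neg_apply, smul_apply, y, mk_apply]
      field_simp [hne q]
      ring
    · have h1 : b q = 0 := by by_contra h; exact hq (hb q h)
      have h2 : y q = 0 := by by_contra h; exact hq (hy q h)
      rw [neg_apply, smul_apply, h1, h2]; simp

theorem star_mul_self_support {a : ConvolutionAlgebra Q} (ha : Set.InjOn rng (tsupport a)) (q : Q)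
    (hq : (star a * a) q ≠ 0) : rng q = q := by
  by_contra hne
  refine hq (conv_eq_zero fun y z hyz hy hz hm => hne ?_)
  have hy' : a (inv y) ≠ 0 := fun h => hy (by rw [star_apply, h, map_zero])
  have h := ha (subset_tsupport a hy') (subset_tsupport a hz) (by rw [rng_inv, hyz])
  subst h
  rw [← hm, rng_mul, mul_congr (inv_inv' y).symm rfl hyz (src_inv _), inv_mul_self, src_inv]

/-- The supremum of all the C⋆-seminorms on `C_c(Q)` is finite. -/
instance instHasLargestCStarSeminorm : HasLargestCStarSeminorm (ConvolutionAlgebra Q) where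
  bddAbove a := by
    obtain ⟨n, F, rfl, hF⟩ := exists_sum_eq a
    have key : ∀ i, ∃ C : ℝ, ∀ p : CStarSeminorm (ConvolutionAlgebra Q), p (F i) ≤ C := by
      intro i
      obtain ⟨e, he, hs⟩ := hF i
      have hinj : Set.InjOn rng (tsupport (F i)) := fun x hx y hy h =>
        e.injOn (hs hx) (hs hy) (by rw [he, he, h])
      set b := star (F i) * F i with hb
      obtain ⟨M, hM⟩ := b.continuous.bounded_above_of_compact_support b.hasCompactSupport
      refine ⟨√(max M 0), fun p => Real.le_sqrt_of_sq_le ?_⟩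
      rw [← p.star_mul_self, ← p.norm_toCompletion]
      have hsa : IsSelfAdjoint (p.toCompletion b) := (IsSelfAdjoint.star_mul_self (F i)).map _
      have hn : IsStarNormal (p.toCompletion b) := hsa.isStarNormal
      obtain ⟨z, hz, hz'⟩ := (NonUnitalIsometricContinuousFunctionalCalculus.isGreatest_norm_quasispectrum
        (𝕜 := ℂ) (p.toCompletion b) hn).1
      rw [← hz']
      rcases norm_le_of_mem_quasispectrum (star_mul_self_support hinj) hM
        (NonUnitalAlgHom.quasispectrum_apply_subset p.toCompletion b hz) with h | h
      · exact h.trans (le_max_left _ _)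
      · simp [h]
    choose C hC using key
    refine ⟨∑ i, C i, ?_⟩
    rintro _ ⟨p, rfl⟩
    exact (Finset.le_sum_of_subadditive p.toSeminorm (map_zero _).le (map_add_le_add _)
      Finset.univ F).trans (Finset.sum_le_sum fun i _ => hC i p)

end Algebra

end ConvolutionAlgebra

/-- The C⋆-algebra `C⋆(Q)` of an r-discrete locally compact Hausdorff groupoid: the enveloping
C⋆-algebra of the convolution ⋆-algebra `C_c(Q)`. -/
abbrev GroupoidCStarAlgebra (Q : Type*) [TopologicalSpace Q] [TopologicalGroupoid Q]
    [IsRDiscrete Q] [T2Space Q] [LocallyCompactSpace Q] : Type _ :=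
  EnvelopingCStarAlgebra (ConvolutionAlgebra Q)

namespace ContinuousGroupoidHom

section ExtendZero

variable {Q G : Type*} [TopologicalSpace Q] [TopologicalGroupoid Q] [Group G] [TopologicalSpace G]
  (c : ContinuousGroupoidHom Q G)

open Classical in
/-- Extension by zero of a function on the kernel. -/
def extendZero (f : c.ker → ℂ) (q : Q) : ℂ := if h : q ∈ c.ker then f ⟨q, h⟩ else 0

theorem extendZero_coe (f : c.ker → ℂ) (q : c.ker) : c.extendZero f q = f q := dif_pos q.2

theorem extendZero_of_notMem (f : c.ker → ℂ) {q : Q} (h : q ∉ c.ker) : c.extendZero f q = 0 :=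
  dif_neg h

theorem mem_of_extendZero_ne {f : c.ker → ℂ} {q : Q} (h : c.extendZero f q ≠ 0) : q ∈ c.ker := by
  by_contra hq
  exact h (c.extendZero_of_notMem f hq)

theorem continuous_extendZero [DiscreteTopology G] {f : c.ker → ℂ} (hf : Continuous f) :
    Continuous (c.extendZero f) := by
  rw [continuous_iff_continuousAt]
  intro q
  by_cases hq : q ∈ c.ker
  · have h1 : ContinuousOn (c.extendZero f) c.ker := by
      rw [continuousOn_iff_continuous_domRestrict]
      exact hf.congr fun n => (c.extendZero_coe f n).symm
    exact h1.continuousAt (c.isClopen_ker.isOpen.mem_nhds hq)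
  · refine ContinuousAt.congr (f := fun _ => (0 : ℂ)) continuousAt_const ?_
    filter_upwards [c.isClopen_ker.isClosed.isOpen_compl.mem_nhds hq] with x hx
    exact (c.extendZero_of_notMem f hx).symm

theorem hasCompactSupport_extendZero [T2Space Q] {f : c.ker → ℂ} (hf : HasCompactSupport f) :
    HasCompactSupport (c.extendZero f) := by
  refine HasCompactSupport.intro (hf.isCompact.image continuous_subtype_val) fun q hq => ?_
  by_contra hne
  have h := c.mem_of_extendZero_ne hne
  refine hq ⟨⟨q, h⟩, subset_tsupport f ?_, rfl⟩
  rw [← Subtype.coe_mk q h, extendZero_coe] at hne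
  exact hne

theorem extendZero_conv (f g : c.ker → ℂ) (x : Q) :
    c.extendZero (ConvolutionAlgebra.conv f g) x =
      ConvolutionAlgebra.conv (c.extendZero f) (c.extendZero g) x := by
  by_cases hx : x ∈ c.ker
  · obtain ⟨x, rfl⟩ : ∃ n : c.ker, n.1 = x := ⟨⟨x, hx⟩, rfl⟩
    rw [extendZero_coe, ConvolutionAlgebra.conv, ConvolutionAlgebra.conv]
    let e : {y : c.ker // rng y = rng x} → {y : Q // rng y = rng x.1} :=
      fun y => ⟨y.1.1, congrArg Subtype.val y.2⟩
    have he : Function.Injective e := fun y y' h =>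
      Subtype.ext (Subtype.ext (congrArg (fun z : {y : Q // rng y = rng x.1} => z.1) h))
    symm
    rw [← finsum_mem_univ, finsum_mem_inter_support_eq' _ Set.univ (Set.range e),
      finsum_mem_range he]
    · refine finsum_congr fun y => ?_
      rw [← c.extendZero_coe f, ← c.extendZero_coe g]
      rfl
    · intro y hy
      simp only [Set.mem_univ, true_iff]
      exact ⟨⟨⟨y.1, c.mem_of_extendZero_ne (left_ne_zero_of_mul hy)⟩, Subtype.ext y.2⟩, rfl⟩
  · rw [extendZero_of_notMem c _ hx]
    refine (ConvolutionAlgebra.conv_eq_zero fun y z hyz hy hz hm => hx ?_).symm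
    exact hm ▸ c.mul_mem_ker hyz (c.mem_of_extendZero_ne hy) (c.mem_of_extendZero_ne hz)

end ExtendZero

variable {Q G : Type*} [TopologicalSpace Q] [TopologicalGroupoid Q] [IsRDiscrete Q] [T2Space Q]
  [LocallyCompactSpace Q] [Group G] [TopologicalSpace G] [DiscreteTopology G]
  (c : ContinuousGroupoidHom Q G)

/-- The inclusion of `C_c(N)` in `C_c(Q)`, `N = c⁻¹(e)`, extending functions by zero. -/
def inclusion : ConvolutionAlgebra c.ker →⋆ₙₐ[ℂ] ConvolutionAlgebra Q where
  toFun f := .mk (c.extendZero f) (c.continuous_extendZero f.continuous)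
    (c.hasCompactSupport_extendZero f.hasCompactSupport)
  map_smul' z f := ConvolutionAlgebra.ext fun q => by
    change c.extendZero (fun n => z * f n) q = z * c.extendZero f q
    unfold extendZero; split_ifs <;> simp
  map_zero' := ConvolutionAlgebra.ext fun q => by
    change c.extendZero (fun _ => 0) q = 0
    unfold extendZero; split_ifs <;> simp
  map_add' f g := ConvolutionAlgebra.ext fun q => by
    change c.extendZero (fun n => f n + g n) q = c.extendZero f q + c.extendZero g q
    unfold extendZero; split_ifs <;> simp
  map_mul' f g := ConvolutionAlgebra.ext fun q => c.extendZero_conv f g q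
  map_star' f := ConvolutionAlgebra.ext fun q => by
    change c.extendZero (fun n => starRingEnd ℂ (f (inv n))) q =
      starRingEnd ℂ (c.extendZero f (inv q))
    by_cases h : q ∈ c.ker
    · rw [← Subtype.coe_mk q h, extendZero_coe]
      exact congrArg _ (c.extendZero_coe f (inv ⟨q, h⟩)).symm
    · rw [extendZero_of_notMem c _ h, extendZero_of_notMem c _ (mt c.inv_mem_ker_iff.1 h), map_zero]

/-- The canonical ⋆-homomorphism `i : C⋆(N) → C⋆(Q)`, `N = c⁻¹(e)`, which extends the inclusion of
`C_c(N)` in `C_c(Q)`. -/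
def canonicalMap : GroupoidCStarAlgebra c.ker →⋆ₙₐ[ℂ] GroupoidCStarAlgebra Q :=
  EnvelopingCStarAlgebra.lift (EnvelopingCStarAlgebra.of.comp c.inclusion)

theorem canonicalMap_of (f : ConvolutionAlgebra c.ker) :
    c.canonicalMap (EnvelopingCStarAlgebra.of f) = EnvelopingCStarAlgebra.of (c.inclusion f) :=
  EnvelopingCStarAlgebra.lift_of _ f

end ContinuousGroupoidHom

end

/-! It suffices that the inclusion of `C_c(N)` in `C_c(Q)` does not decrease the largest
C⋆-seminorms (`largestCStarSeminorm_le`). The inequality passes to the completions by density, and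
injectivity follows.

To bound the largest C⋆-seminorm `p` of `C_c(N)`, one needs a C⋆-seminorm on `C_c(Q)` that is at
least `p` on `C_c(N)`. It is found by inducing along restriction of functions `P : C_c(Q) → C_c(N)`.
With the inner product `P (x⋆ y)`, the space `C_c(Q)` is a pre-Hilbert module over `C_c(N)`, and the
operator seminorm `q` of left multiplication is a C⋆-seminorm (`exists_cstarSeminorm`). Testing `q
a`, for `a` in `C_c(N)`, on a right unit of `a` with `p`-seminorm at most one gives `p a ≤ q a`.

Two points depend on the groupoid.

Positivity: `P (x⋆ x)` is a finite sum of squares in `C_c(N)`. The homomorphism `c` grades `C_c(Q)`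
by `G`, and `P` kills the cross terms between different degrees. For `x` of degree `g`, a partition
of unity on the range of `x` is written as `∑ aᵢ aᵢ⋆` with `aᵢ` of degree `g`, so `x⋆ x = ∑ (aᵢ⋆ x)⋆
(aᵢ⋆ x)` with each `aᵢ⋆ x` in `C_c(N)`.

Boundedness: every `a` is a finite sum of functions supported in sets on which the range map is
injective. For such a function `a⋆ a` is a bounded function on the units, and a square root of `M -
a⋆ a` exhibits `M x⋆ x - (a x)⋆ (a x)` as a square. -/

noncomputable section

/-! ### Algebraic positivity and C⋆-seminorms -/

section SumsOfSquares

/-- The cone of finite sums of elements `a⋆ a`. -/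
def sumsOfSquares (A : Type*) [NonUnitalRing A] [StarRing A] : AddSubmonoid A :=
  AddSubmonoid.closure (Set.range fun a : A => star a * a)

theorem star_mul_self_mem_sumsOfSquares {A : Type*} [NonUnitalRing A] [StarRing A] (a : A) :
    star a * a ∈ sumsOfSquares A :=
  AddSubmonoid.subset_closure ⟨a, rfl⟩

variable {A : Type*} [NonUnitalRing A] [Module ℂ A] [StarRing A]

/-- The ⋆-algebra itself carries no order. Sums of squares serve as an algebraic certificate of
positivity that every ⋆-homomorphism into a C⋆-algebra respects. -/
theorem map_nonneg_of_mem_sumsOfSquares {B : Type*} [NonUnitalCStarAlgebra B] [PartialOrder B]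
    [StarOrderedRing B] (φ : A →⋆ₙₐ[ℂ] B) {a : A} (ha : a ∈ sumsOfSquares A) : 0 ≤ φ a := by
  induction ha using AddSubmonoid.closure_induction with
  | mem x hx =>
    obtain ⟨y, rfl⟩ := hx
    simp only [map_mul, map_star]
    exact star_mul_self_nonneg _
  | zero => rw [map_zero]
  | add x y _ _ hx hy => rw [map_add]; exact add_nonneg hx hy

namespace CStarSeminorm

variable [IsScalarTower ℂ A A] [SMulCommClass ℂ A A] [StarModule ℂ A] (p : CStarSeminorm A)

/-- In the completion for `p`, with its spectral order, the hypotheses become `0 ≤ a ≤ b`, and a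
C⋆-norm is monotone on positive elements. -/
theorem le_of_sub_mem_sumsOfSquares {a b : A} (ha : a ∈ sumsOfSquares A)
    (hb : b - a ∈ sumsOfSquares A) : p a ≤ p b := by
  let _ := CStarAlgebra.spectralOrder (UniformSpace.Completion p.Carrier)
  have _ := CStarAlgebra.spectralOrderedRing (UniformSpace.Completion p.Carrier)
  have h1 := map_nonneg_of_mem_sumsOfSquares p.toCompletion ha
  have h2 := map_nonneg_of_mem_sumsOfSquares p.toCompletion hb
  rw [map_sub, sub_nonneg] at h2
  rw [← p.norm_toCompletion, ← p.norm_toCompletion]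
  exact CStarAlgebra.norm_le_norm_of_nonneg_of_le h1 h2

/-- The inequality behind the Cauchy–Schwarz inequality for pre-Hilbert modules. -/
theorem sq_le_of_mem_sumsOfSquares {a x y : A} {t : ℝ} (hx : x ∈ sumsOfSquares A) (ht : 0 < t) (hxt : p x ≤ t)
    (h : star a * x * a - (2 * t : ℂ) • (star a * a) + (t ^ 2 : ℂ) • y ∈ sumsOfSquares A) :
    p a ^ 2 ≤ t * p y := by
  let _ := CStarAlgebra.spectralOrder (UniformSpace.Completion p.Carrier)
  have _ := CStarAlgebra.spectralOrderedRing (UniformSpace.Completion p.Carrier)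
  set φ := p.toCompletion
  have h0 := map_nonneg_of_mem_sumsOfSquares φ h
  have hx0 := map_nonneg_of_mem_sumsOfSquares φ hx
  have h1 : star (φ a) * φ x * φ a ≤ ‖φ x‖ • (star (φ a) * φ a) :=
    CStarAlgebra.star_left_conjugate_le_norm_smul (IsSelfAdjoint.of_nonneg hx0)
  have h2 : ‖φ x‖ • (star (φ a) * φ a) ≤ t • (star (φ a) * φ a) :=
    smul_le_smul_of_nonneg_right ((p.norm_toCompletion x).trans_le hxt) (star_mul_self_nonneg _)
  -- By `h1` and `h2` the term `a⋆ x a` in the hypothesis is at most `t a⋆ a`, so that `0 ≤ -t a⋆ a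
  -- + t² y`.
  have h3 : t • (star (φ a) * φ a) ≤ (t ^ 2) • φ y := by
    have e1 : φ ((2 * t : ℂ) • (star a * a)) = (2 * t) • (star (φ a) * φ a) := by
      rw [map_smul, map_mul, StarHomClass.map_star, ← Complex.coe_smul]; norm_num
    have e2 : φ ((t ^ 2 : ℂ) • y) = (t ^ 2) • φ y := by
      rw [map_smul, ← Complex.coe_smul]; norm_num
    rw [map_add, map_sub, e1, e2, map_mul, map_mul, StarHomClass.map_star] at h0
    have h4 := h0.trans (add_le_add_left (sub_le_sub_right (h1.trans h2) _) _)
    rw [two_mul, add_smul] at h4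
    rw [← sub_nonneg]
    convert h4 using 1
    abel
  have h5 : star (φ a) * φ a ≤ t • φ y := by
    have := smul_le_smul_of_nonneg_left h3 (inv_nonneg.2 ht.le)
    rwa [smul_smul, smul_smul, inv_mul_cancel₀ ht.ne', one_smul, sq,
      inv_mul_cancel_left₀ ht.ne'] at this
  have h6 := CStarAlgebra.norm_le_norm_of_nonneg_of_le (star_mul_self_nonneg (φ a)) h5
  rw [CStarRing.norm_star_mul_self, norm_smul, Real.norm_of_nonneg ht.le, p.norm_toCompletion,
    p.norm_toCompletion, ← sq] at h6
  exact h6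

end CStarSeminorm

end SumsOfSquares

/-! ### Pre-Hilbert modules from an algebraic expectation -/

/-- A linear retraction `P` of `ι : A → E` which is a map of right `A`-modules, commutes with the
involutions and maps the elements `x⋆ x` to sums of squares. -/
structure AlgebraicExpectation {A E : Type*} [NonUnitalRing A] [Module ℂ A] [StarRing A]
    [NonUnitalRing E] [Module ℂ E] [StarRing E] (ι : A →⋆ₙₐ[ℂ] E) extends E →ₗ[ℂ] A where
  map_mul_map : ∀ (x : E) (a : A), toFun (x * ι a) = toFun x * a
  map_star' : ∀ x : E, toFun (star x) = star (toFun x)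
  map_map : ∀ a : A, toFun (ι a) = a
  map_star_mul_self_mem : ∀ x : E, toFun (star x * x) ∈ sumsOfSquares A

namespace AlgebraicExpectation

variable {A E : Type*} [NonUnitalRing A] [Module ℂ A] [StarRing A]
  [NonUnitalRing E] [Module ℂ E] [StarRing E] {ι : A →⋆ₙₐ[ℂ] E}

instance instCoeFun : CoeFun (AlgebraicExpectation ι) fun _ => E → A := ⟨fun P => P.toLinearMap⟩

variable (P : AlgebraicExpectation ι)

theorem map_mul_map_apply (x : E) (a : A) : P (x * ι a) = P x * a := P.map_mul_map x a
theorem map_star_apply (x : E) : P (star x) = star (P x) := P.map_star' x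
theorem map_map_apply (a : A) : P (ι a) = a := P.map_map a
theorem map_star_mul_self_mem_apply (x : E) : P (star x * x) ∈ sumsOfSquares A :=
  P.map_star_mul_self_mem x

theorem map_map_mul (a : A) (x : E) : P (ι a * x) = a * P x := by
  rw [← star_inj, ← P.map_star_apply, star_mul, ← map_star, P.map_mul_map_apply, star_mul,
    P.map_star_apply]

variable [IsScalarTower ℂ A A] [SMulCommClass ℂ A A] [StarModule ℂ A]
  [IsScalarTower ℂ E E] [SMulCommClass ℂ E E] [StarModule ℂ E] (p : CStarSeminorm A)

/-- The Cauchy–Schwarz inequality for the `A`-valued inner product `P (x⋆ y)`. -/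
theorem sq_le (x y : E) :
    p (P (star x * y)) ^ 2 ≤ p (P (star x * x)) * p (P (star y * y)) := by
  -- The argument divides by `t`, and `p (P (x⋆ x))` may vanish. Hence the bound is proved for every
  -- larger `t`, which then decreases to `p (P (x⋆ x))`.
  have key : ∀ t : ℝ, p (P (star x * x)) < t →
      p (P (star x * y)) ^ 2 ≤ t * p (P (star y * y)) := fun t ht => by
    refine p.sq_le_of_mem_sumsOfSquares (P.map_star_mul_self_mem_apply x)
      ((p.nonneg _).trans_lt ht) ht.le ?_
    set a := P (star x * y) with ha
    have ha' : P (star y * x) = star a := by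
      rw [ha, ← P.map_star_apply, star_mul, star_star]
    -- As for Hilbert spaces, positivity is applied to `x a - t y` with `a = P (x⋆ y)`. Module
    -- linearity of `P` turns the expansion into `a⋆ P(x⋆ x) a - 2t a⋆ a + t² P(y⋆ y)`.
    have := P.map_star_mul_self_mem_apply (x * ι a - (t : ℂ) • y)
    convert this using 1
    have e : star (x * ι a - (t : ℂ) • y) * (x * ι a - (t : ℂ) • y) =
        ι (star a) * (star x * x * ι a) - (t : ℂ) • (ι (star a) * (star x * y))
          - (t : ℂ) • (star y * x * ι a) + (t ^ 2 : ℂ) • (star y * y) := by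
      simp only [star_sub, star_mul, star_smul, sub_mul, mul_sub, smul_mul_assoc, mul_smul_comm,
        smul_sub, map_star, mul_assoc, smul_smul, RCLike.star_def, Complex.conj_ofReal, sq]
      abel
    rw [e, map_add, map_sub, map_sub, map_smul, map_smul, map_smul, P.map_map_mul, P.map_map_mul,
      P.map_mul_map_apply, P.map_mul_map_apply, ha', ← ha, two_mul, add_smul, mul_assoc]
    abel
  have h : Filter.Tendsto (fun t : ℝ => t * p (P (star y * y)))
      (nhdsWithin (p (P (star x * x))) (Set.Ioi (p (P (star x * x)))))
      (nhds (p (P (star x * x)) * p (P (star y * y)))) :=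
    (continuous_id.mul continuous_const).continuousWithinAt.tendsto
  refine ge_of_tendsto h ?_
  filter_upwards [self_mem_nhdsWithin] with t ht using key t ht

/-- The two cross terms of `(x + y)⋆ (x + y)` are adjoint to each other, so they have equal
seminorms, and Cauchy–Schwarz bounds each by the product of the two roots. -/
theorem star_mul_self_add (x y : E) : √(p (P (star (x + y) * (x + y)))) ≤
    √(p (P (star x * x))) + √(p (P (star y * y))) := by
  have h1 := P.sq_le p x y
  have h2 : p (P (star y * x)) = p (P (star x * y)) := by
    rw [← p.map_star, ← P.map_star_apply, star_mul, star_star]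
  have h3 : p (P (star x * y)) ≤ √(p (P (star x * x))) * √(p (P (star y * y))) := by
    rw [← Real.sqrt_mul (p.nonneg _)]
    exact Real.le_sqrt_of_sq_le h1
  refine Real.sqrt_le_iff.2 ⟨by positivity, ?_⟩
  have e : star (x + y) * (x + y) = star x * x + star x * y + (star y * x + star y * y) := by
    rw [star_add, add_mul, mul_add, mul_add]
  rw [e, map_add P.toLinearMap, map_add P.toLinearMap, map_add P.toLinearMap]
  have h4 := map_add_le_add p.toSeminorm (P (star x * x) + P (star x * y))
    (P (star y * x) + P (star y * y))
  have h5 := map_add_le_add p.toSeminorm (P (star x * x)) (P (star x * y))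
  have h6 := map_add_le_add p.toSeminorm (P (star y * x)) (P (star y * y))
  have h7 := Real.sq_sqrt (p.nonneg (P (star x * x)))
  have h8 := Real.sq_sqrt (p.nonneg (P (star y * y)))
  nlinarith

/-- The seminorm `‖P (x⋆ x)‖^{1/2}` of the pre-Hilbert `A`-module `E`. -/
def moduleSeminorm : Seminorm ℂ E :=
  Seminorm.ofSMulLE (fun x => √(p (P (star x * x)))) (by simp) (P.star_mul_self_add p)
    fun c x => by
      rw [star_smul, smul_mul_smul_comm, map_smul, map_smul_eq_mul, norm_mul, norm_star,
        Real.sqrt_mul (by positivity), Real.sqrt_mul_self (norm_nonneg c)]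

theorem moduleSeminorm_apply (x : E) : P.moduleSeminorm p x = √(p (P (star x * x))) := rfl

theorem moduleSeminorm_sq (x : E) : P.moduleSeminorm p x ^ 2 = p (P (star x * x)) :=
  Real.sq_sqrt (p.nonneg _)

/-- Since `P` is a retraction, `P (ι(a)⋆ ι(a)) = a⋆ a`, and the C⋆-identity of `p` applies. Thus the
module seminorm extends `p`. -/
theorem moduleSeminorm_map (a : A) : P.moduleSeminorm p (ι a) = p a := by
  rw [moduleSeminorm_apply, ← map_star, ← map_mul, P.map_map_apply, p.star_mul_self,
    Real.sqrt_sq (p.nonneg a)]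

/-- The C⋆-seminorm of `E` acting by left multiplication on a pre-Hilbert `A`-module. -/
theorem exists_cstarSeminorm
    (hb : ∀ a : E, ∃ C : ℝ, 0 ≤ C ∧ ∀ x, P.moduleSeminorm p (a * x) ≤ C * P.moduleSeminorm p x) :
    ∃ q : CStarSeminorm E, ∀ a x, P.moduleSeminorm p (a * x) ≤ q a * P.moduleSeminorm p x := by
  set n := P.moduleSeminorm p with hn
  let S : E → Set ℝ := fun a => {C | 0 ≤ C ∧ ∀ x, n (a * x) ≤ C * n x}
  -- The operator seminorm of left multiplication by `a`, as the infimum of its admissible bounds;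
  -- the set is non-empty by `hb`.
  let q : E → ℝ := fun a => sInf (S a)
  have hS : ∀ a, BddBelow (S a) := fun a => ⟨0, fun C hC => hC.1⟩
  have q0 : ∀ a, 0 ≤ q a := fun a => le_csInf (hb a) fun C hC => hC.1
  have hq : ∀ a x, n (a * x) ≤ q a * n x := fun a x => by
    -- When `n x = 0` one cannot divide by it, but any admissible bound already forces `n (a * x) =
    -- 0`.
    rcases (apply_nonneg n x).eq_or_lt with h | h
    · obtain ⟨C, hC⟩ := hb a
      have := hC.2 x
      rw [← h] at this ⊢
      simpa using this
    · rw [← div_le_iff₀ h]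
      exact le_csInf (hb a) fun C hC => (div_le_iff₀ h).2 (hC.2 x)
  have qle : ∀ a C, 0 ≤ C → (∀ x, n (a * x) ≤ C * n x) → q a ≤ C := fun a C h0 h =>
    csInf_le (hS a) ⟨h0, h⟩
  have qmul : ∀ a b, q (a * b) ≤ q a * q b := fun a b =>
    qle _ _ (mul_nonneg (q0 a) (q0 b)) fun x => by
      rw [mul_assoc, mul_assoc]
      exact (hq _ _).trans (mul_le_mul_of_nonneg_left (hq _ _) (q0 a))
  -- Left multiplication by `a⋆` is adjoint to that by `a`: `n(a x)² = p (P (x⋆ (a⋆ a x))) ≤ n(x)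
  -- n(a⋆ a x) ≤ q(a⋆ a) n(x)²`, by Cauchy–Schwarz.
  have qsq : ∀ a, q a ^ 2 ≤ q (star a * a) := fun a => by
    refine (Real.le_sqrt (q0 a) (q0 _)).1 (qle _ _ (Real.sqrt_nonneg _) fun x => ?_)
    refine (abs_le_of_sq_le_sq' ?_ (mul_nonneg (Real.sqrt_nonneg _) (apply_nonneg n x))).2
    rw [mul_pow, Real.sq_sqrt (q0 _), P.moduleSeminorm_sq]
    have e : star (a * x) * (a * x) = star x * (star a * a * x) := by
      rw [star_mul]; simp only [mul_assoc]
    have h1 := P.sq_le p x (star a * a * x)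
    rw [← P.moduleSeminorm_sq, ← P.moduleSeminorm_sq, ← hn, ← mul_pow] at h1
    rw [e]
    refine (abs_le_of_sq_le_sq' h1 (mul_nonneg (apply_nonneg n _) (apply_nonneg n _))).2.trans ?_
    nlinarith [hq (star a * a) x, apply_nonneg n x]
  have qstar : ∀ a, q a ≤ q (star a) := fun a => by
    have h := (qsq a).trans (qmul _ _)
    by_contra! hc
    nlinarith [q0 a, q0 (star a)]
  have qstar' : ∀ a, q (star a) = q a := fun a =>
    le_antisymm (by simpa using qstar (star a)) (qstar a)
  refine ⟨{ toSeminorm := Seminorm.ofSMulLE q ?_ ?_ ?_, mul_le' := qmul, star_mul_self' := ?_ }, hq⟩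
  · exact le_antisymm (qle _ _ le_rfl fun x => by simp) (q0 0)
  · intro a b
    refine qle _ _ (add_nonneg (q0 a) (q0 b)) fun x => ?_
    rw [add_mul, add_mul]
    exact (map_add_le_add n _ _).trans (add_le_add (hq a x) (hq b x))
  · intro c a
    refine qle _ _ (mul_nonneg (norm_nonneg c) (q0 a)) fun x => ?_
    rw [smul_mul_assoc, map_smul_eq_mul, mul_assoc]
    exact mul_le_mul_of_nonneg_left (hq a x) (norm_nonneg c)
  · exact fun a => le_antisymm ((qmul _ _).trans_eq (by rw [qstar' a]; exact (sq (q a)).symm)) (qsq a)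

end AlgebraicExpectation

end
-- Multipliers, bisections and local units in `C_c(Q)`
noncomputable section

open TopologicalGroupoid

namespace ConvolutionAlgebra

variable {Q : Type*} [TopologicalSpace Q] [TopologicalGroupoid Q]

/-- The function `q ↦ w (r q) x q`. -/
def rngMul (w : Q → ℂ) (hw : Continuous w) (x : ConvolutionAlgebra Q) : ConvolutionAlgebra Q :=
  mk (fun q => w (rng q) * x q) ((hw.comp continuous_rng).mul x.continuous)
    x.hasCompactSupport.mul_left

variable [IsRDiscrete Q] [T2Space Q] [LocallyCompactSpace Q]

/-- In the summand at `z` both weights are evaluated at the same unit, because `r(z⁻¹ q) = r(z⁻¹)`.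
So multiplication by `w ∘ r` has the adjoint `w̄ ∘ r`, although `w` need not have compact support
and so need not come from an element of the algebra. -/
theorem star_rngMul_mul (w : Q → ℂ) (hw : Continuous w) (x y : ConvolutionAlgebra Q) :
    star (rngMul w hw x) * y =
      star x * rngMul (fun q => starRingEnd ℂ (w q)) (Complex.continuous_conj.comp hw) y := by
  refine ext fun q => finsum_congr fun z => ?_
  simp only [star_apply, rngMul, mk_apply, rng_mul, map_mul]
  ring

/-- The value of `a⋆ a` at a unit is non-negative. -/
theorem star_mul_self_apply_unit (a : ConvolutionAlgebra Q) (q : Q) :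
    (star a * a) (rng q) = (((star a * a) (rng q)).re : ℂ) ∧ 0 ≤ ((star a * a) (rng q)).re := by
  have h : ∃ r : ℝ, 0 ≤ r ∧ (star a * a) (rng q) = r := by
    refine ⟨∑ᶠ y : {y : Q // rng y = rng (rng q)}, ‖a (inv y)‖ ^ 2,
      finsum_nonneg fun y => sq_nonneg _, ?_⟩
    rw [mul_apply, conv]
    trans ∑ᶠ y : {y : Q // rng y = rng (rng q)}, ((‖a (inv y)‖ ^ 2 : ℝ) : ℂ)
    · refine finsum_congr fun y => ?_
      rw [star_apply, mul_eq_left' (rng_rng q), Complex.conj_mul', Complex.ofReal_pow]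
    -- Injectivity of the embedding of the reals makes it commute with `finsum` without a finiteness
    -- check.
    · exact (AddMonoidHom.map_finsum_of_injective (Complex.ofRealHom : ℝ →+ ℂ)
        Complex.ofReal_injective _).symm
  obtain ⟨r, hr, h⟩ := h
  rw [h]
  exact ⟨by simp, by simpa using hr⟩

/-- If the range map is injective on the support of `a`, then `M x⋆ x - (a x)⋆ (a x)` is of the
form `h⋆ h` for a constant `M`. -/
theorem exists_star_mul_self_add {a : ConvolutionAlgebra Q} (ha : Set.InjOn rng (tsupport a)) :
    ∃ M : ℝ, 0 ≤ M ∧ ∀ x : ConvolutionAlgebra Q, ∃ h : ConvolutionAlgebra Q,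
      star h * h + star (a * x) * (a * x) = (M : ℂ) • (star x * x) := by
  set b := star a * a with hb
  obtain ⟨M, hM⟩ := b.continuous.bounded_above_of_compact_support b.hasCompactSupport
  refine ⟨max M 0, le_max_right _ _, fun x => ?_⟩
  -- The witness is `x` multiplied by `w ∘ r`, with `w = √(M - a⋆ a)`. The function `a⋆ a` is
  -- supported in the unit space, where it is real and bounded by `M`.
  have hw : Continuous fun q => ((√(max M 0 - (b q).re) : ℝ) : ℂ) :=
    Complex.continuous_ofReal.comp
      ((continuous_const.sub (Complex.continuous_re.comp b.continuous)).sqrt)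
  refine ⟨rngMul _ hw x, ?_⟩
  -- Left convolution by `b` is multiplication by `b ∘ r`, so `w̄ w x + b x = M x`. Pairing this
  -- with `x⋆` gives the claim.
  have e : rngMul (fun q => starRingEnd ℂ ((√(max M 0 - (b q).re) : ℝ) : ℂ))
      (Complex.continuous_conj.comp hw) (rngMul _ hw x) + b * x =
      ((max M 0 : ℝ) : ℂ) • x := ext fun q => by
    rw [add_apply, smul_apply, mul_apply, conv_of_unit (star_mul_self_support ha),
      (star_mul_self_apply_unit a q).1]
    simp only [rngMul, mk_apply, Complex.conj_ofReal]
    rw [← mul_assoc, ← Complex.ofReal_mul, Real.mul_self_sqrt]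
    · push_cast; ring
    · have := (Complex.abs_re_le_norm _).trans (hM (rng q))
      have := le_abs_self (b (rng q)).re
      have := le_max_left M 0
      linarith
  rw [star_rngMul_mul, star_mul, mul_assoc, ← mul_assoc (star a), ← hb, ← mul_add, e,
    mul_smul_comm]

/-- A non-negative function `φ` with compact support in the range of an open bisection is of the form
`a a⋆` with `a` supported in the bisection; stated as the action of `a a⋆` by multiplication. -/
theorem exists_mul_star_eq (e : OpenPartialHomeomorph Q Q) (he : ∀ q, e q = rng q)
    (hinj : Set.InjOn src e.source) (φ : C(Q, ℝ)) (hφ : HasCompactSupport φ) (hφe : tsupport φ ⊆ e.target) (hφ0 : ∀ q, 0 ≤ φ q) :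
    ∃ a : ConvolutionAlgebra Q, (∀ q, a q ≠ 0 → q ∈ e.source) ∧
      ∀ x : ConvolutionAlgebra Q, ∀ q, (a * (star a * x)) q = φ (rng q) * x q := by
  classical
  -- The root of `φ ∘ r` on the bisection, extended by zero. Continuity holds across the boundary
  -- because the support lies in the image of `tsupport φ` under the inverse of `e`, a compact
  -- subset of the bisection.
  let f : Q → ℂ := Set.indicator e.source fun q => ((√(φ (rng q)) : ℝ) : ℂ)
  have hf0 : ∀ q, f q ≠ 0 → q ∈ e.source := fun q hq => by
    by_contra h
    exact hq (Set.indicator_of_notMem h _)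
  have hK : IsCompact (e.symm '' tsupport φ) :=
    hφ.isCompact.image_of_continuousOn (e.continuousOn_symm.mono hφe)
  have hf1 : ∀ q, q ∉ e.symm '' tsupport φ → f q = 0 := fun q hq => by
    by_contra h
    have hφq : φ (rng q) ≠ 0 := fun h0 => h (by
      simp only [f, Set.indicator_apply, h0, Real.sqrt_zero, Complex.ofReal_zero, ite_self])
    exact hq ⟨rng q, subset_tsupport (φ : Q → ℝ) hφq, by rw [← he, e.left_inv (hf0 q h)]⟩
  have hfc : Continuous f := by
    rw [continuous_iff_continuousAt]
    intro q
    by_cases hq : q ∈ e.source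
    · refine ContinuousAt.congr (f := fun q => ((√(φ (rng q)) : ℝ) : ℂ))
        (Complex.continuous_ofReal.comp (φ.continuous.comp continuous_rng).sqrt).continuousAt ?_
      filter_upwards [e.open_source.mem_nhds hq] with z hz
      exact (Set.indicator_of_mem hz fun q => ((√(φ (rng q)) : ℝ) : ℂ)).symm
    · have hq' : q ∉ e.symm '' tsupport φ := by
        rintro ⟨u, hu, rfl⟩
        exact hq (e.map_target (hφe hu))
      refine ContinuousAt.congr (f := fun _ => (0 : ℂ)) continuousAt_const ?_
      filter_upwards [hK.isClosed.isOpen_compl.mem_nhds hq'] with z hz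
      exact (hf1 z hz).symm
  refine ⟨mk f hfc (HasCompactSupport.intro hK hf1), hf0, fun x q => ?_⟩
  set a := mk f hfc (HasCompactSupport.intro hK hf1) with ha
  -- Injectivity of the source map is what places `a a⋆` in the unit space: in a product `y z`
  -- contributing to it, `y` and `z⁻¹` lie in the bisection and have the same source.
  have hunit : ∀ q, (a * star a) q ≠ 0 → rng q = q := fun q hq => by
    by_contra hne
    refine hq (conv_eq_zero fun y z hyz hy hz hm => hne ?_)
    have hz' : a (inv z) ≠ 0 := fun h => hz (by rw [star_apply, h, map_zero])
    have h := hinj (hf0 y hy) (hf0 _ hz') (by rw [src_inv, hyz])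
    rw [← hm, rng_mul, mul_congr rfl (by rw [h, inv_inv'] : z = inv y) _ (rng_inv y).symm,
      mul_inv_self]
  rw [← mul_assoc, mul_apply, conv_of_unit hunit]
  congr 1
  -- At the unit `r(q)` at most one `y` contributes, the point of the bisection above `r(q)`, and it
  -- gives `√φ · √φ`. If there is no such point, both sides vanish.
  by_cases hq : rng q ∈ e.target
  · have hr : rng (e.symm (rng q)) = rng (rng q) := by rw [← he, e.right_inv hq, rng_rng]
    rw [mul_apply, conv, finsum_eq_single _ (⟨e.symm (rng q), hr⟩ : {y : Q // rng y = rng (rng q)})]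
    · rw [star_apply, mul_eq_left' (rng_rng q), inv_inv']
      have h1 : a (e.symm (rng q)) = ((√(φ (rng q)) : ℝ) : ℂ) := by
        rw [ha, mk_apply]
        simp only [f]
        rw [Set.indicator_of_mem (e.map_target hq), hr, rng_rng]
      rw [h1, Complex.conj_ofReal, ← Complex.ofReal_mul, Real.mul_self_sqrt (hφ0 _)]
    · intro y hy
      by_contra hne
      have hys := hf0 _ (left_ne_zero_of_mul hne)
      refine hy (Subtype.ext ?_)
      change y.1 = e.symm (rng q)
      rw [← e.left_inv hys, he, y.2, rng_rng]
  · have h0 : φ (rng q) = 0 := by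
      by_contra h
      exact hq (hφe (subset_tsupport φ h))
    rw [h0, Complex.ofReal_zero]
    refine conv_eq_zero fun y z hyz hy hz hm => hq ?_
    rw [← rng_rng q, ← hm, rng_mul, ← he]
    exact e.map_source (hf0 y hy)

/-- A partition of the identity of the range of `x` by elements `a a⋆` with `a` supported in a given
neighbourhood of the support of `x`. -/
theorem exists_sum_mul_star_mul (x : ConvolutionAlgebra Q) {U : Set Q} (hU : IsOpen U)
    (hx : tsupport x ⊆ U) : ∃ (n : ℕ) (E : Fin n → ConvolutionAlgebra Q),
      (∀ i q, E i q ≠ 0 → q ∈ U) ∧ ∑ i, E i * (star (E i) * x) = x := by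
  choose e hxe he using IsRDiscrete.isLocalHomeomorph_rng (Q := Q)
  -- The chart at `q` makes the range map injective. Intersecting with the inverse of a chart at
  -- `q⁻¹` makes the source map injective too, and intersecting with `U` confines the supports.
  have hV : ∀ q, IsOpen (U ∩ inv ⁻¹' (e (inv q)).source) := fun q =>
    hU.inter ((e (inv q)).open_source.preimage continuous_inv')
  let e' : Q → OpenPartialHomeomorph Q Q := fun q => (e q).restrOpen _ (hV q)
  have he' : ∀ q z, e' q z = rng z := fun q z => (congrFun (he q) z).symm
  have hs : ∀ q, (e' q).source = (e q).source ∩ (U ∩ inv ⁻¹' (e (inv q)).source) :=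
    fun q => (e q).restrOpen_source _ (hV q)
  have hinj : ∀ q, Set.InjOn src (e' q).source := fun q y hy z hz h => by
    rw [hs] at hy hz
    have := (e (inv q)).injOn hy.2.2 hz.2.2 (by rw [← he, rng_inv, rng_inv, h])
    rw [← inv_inv' y, this, inv_inv']
  have hcov : rng '' tsupport x ⊆ ⋃ q, (e' q).target := by
    rintro _ ⟨q, hq, rfl⟩
    refine Set.mem_iUnion.2 ⟨q, ?_⟩
    rw [← he' q]
    exact (e' q).map_source (by rw [hs]; exact ⟨hxe q, hx hq, hxe (inv q)⟩)
  have hK := x.hasCompactSupport.isCompact.image continuous_rng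
  obtain ⟨t, ht⟩ := hK.elim_finite_subcover _ (fun q => (e' q).open_target) hcov
  let ι := t.equivFin.symm
  -- The partition of unity lives on the range of the support of `x`; composed with the range map it
  -- sums to one wherever `x` is non-zero.
  obtain ⟨φ, hφ1, hφ2, hφ3, hφ4⟩ := exists_continuous_sum_one_of_isOpen_isCompact
    (s := fun i => (e' (ι i).1).target) (fun i => (e' (ι i).1).open_target) hK (by
      refine ht.trans fun q hq => ?_
      simp only [Set.mem_iUnion] at hq ⊢
      obtain ⟨y, hy, hqy⟩ := hq
      exact ⟨t.equivFin ⟨y, hy⟩, by simpa [ι] using hqy⟩)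
  choose E hE hE' using fun i => exists_mul_star_eq (e' (ι i).1) (he' _) (hinj _) (φ i) (hφ4 i) (hφ1 i)
    fun q => (hφ3 i q).1
  refine ⟨_, E, fun i q hq => ?_, ext fun q => ?_⟩
  · have := hE i q hq
    rw [hs] at this
    exact this.2.1
  · rw [sum_apply]
    simp only [hE']
    rw [← Finset.sum_mul]
    by_cases hq : x q = 0
    · rw [hq, mul_zero]
    · have := hφ2 ⟨q, subset_tsupport x hq, rfl⟩
      simp only [Finset.sum_apply, Pi.one_apply] at this
      rw [← Complex.ofReal_sum, this, Complex.ofReal_one, one_mul]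

/-- A C⋆-seminorm is at most the supremum norm on the self-adjoint elements supported in the unit
space. -/
theorem cstarSeminorm_le_of_unit (p : CStarSeminorm (ConvolutionAlgebra Q))
    {b : ConvolutionAlgebra Q} (hb : IsSelfAdjoint b) (hb' : ∀ q, b q ≠ 0 → rng q = q) {M : ℝ}
    (hM0 : 0 ≤ M) (hM : ∀ q, ‖b q‖ ≤ M) : p b ≤ M := by
  rw [← p.norm_toCompletion]
  have hn : IsStarNormal (p.toCompletion b) := (hb.map p.toCompletion).isStarNormal
  -- The norm of a normal element of a C⋆-algebra is attained on its quasispectrum, and a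
  -- homomorphism can only shrink the quasispectrum. This reduces the bound to one inside `C_c(Q)`.
  obtain ⟨z, hz, hz'⟩ := (NonUnitalIsometricContinuousFunctionalCalculus.isGreatest_norm_quasispectrum
    (𝕜 := ℂ) (p.toCompletion b) hn).1
  rw [← hz']
  rcases norm_le_of_mem_quasispectrum hb' hM
    (NonUnitalAlgHom.quasispectrum_apply_subset p.toCompletion b hz) with h | h
  · exact h
  · simpa [h] using hM0

/-- Every element of `C_c(Q)` has a right unit of norm at most one in every C⋆-seminorm. -/
theorem exists_mul_eq_self (a : ConvolutionAlgebra Q) : ∃ f : ConvolutionAlgebra Q,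
    a * f = a ∧ ∀ p : CStarSeminorm (ConvolutionAlgebra Q), p f ≤ 1 := by
  -- A Urysohn function with values in `[0, 1]`, equal to one on `r(supp a⋆) = s(supp a)` and
  -- vanishing off the open unit space.
  obtain ⟨ψ, hψ1, hψ0, hψc, hψ⟩ := exists_continuous_one_zero_of_isCompact
    ((star a).hasCompactSupport.isCompact.image continuous_rng)
    (IsRDiscrete.isOpen_unitSpace (Q := Q)).isClosed_compl (by
      rw [Set.disjoint_compl_right_iff_subset]
      rintro _ ⟨q, -, rfl⟩
      exact rng_rng q)
  let f : ConvolutionAlgebra Q := mk (fun q => (ψ q : ℂ))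
    (Complex.continuous_ofReal.comp ψ.continuous) (hψc.comp_left Complex.ofReal_zero)
  have hf : ∀ q, f q ≠ 0 → rng q = q := fun q hq => by
    by_contra h
    exact hq (by simp only [f, mk_apply]; rw [hψ0 h]; simp)
  have hsa : IsSelfAdjoint f := ext fun q => by
    rw [star_apply]
    by_cases hq : rng q = q
    · rw [← hq, inv_rng]
      exact Complex.conj_ofReal _
    · have h1 : f q = 0 := by_contra fun h => hq (hf q h)
      have h2 : f (inv q) = 0 := by_contra fun h => hq (by
        have h3 := hf _ h
        rw [← inv_inv' q, ← h3, inv_rng, rng_rng])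
      rw [h1, h2, map_zero]
  refine ⟨f, ?_, fun p => cstarSeminorm_le_of_unit p hsa hf zero_le_one fun q => ?_⟩
  -- Adjoints turn the right unit into a left one, where convolution by a function on the units is
  -- pointwise multiplication.
  · rw [← star_inj, star_mul, hsa.star_eq]
    refine ext fun q => ?_
    rw [mul_apply, conv_of_unit hf]
    by_cases hq : (star a) q = 0
    · rw [hq, mul_zero]
    · have : ψ (rng q) = 1 := hψ1 ⟨q, subset_tsupport _ hq, rfl⟩
      simp only [f, mk_apply, this, Complex.ofReal_one, one_mul]
  · simp only [f, mk_apply, Complex.norm_real]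
    rw [Real.norm_of_nonneg (hψ q).1]
    exact (hψ q).2

end ConvolutionAlgebra

/-! ### Restriction to the kernel as an expectation -/

namespace ContinuousGroupoidHom

open ConvolutionAlgebra

variable {Q G : Type*} [TopologicalSpace Q] [TopologicalGroupoid Q] [IsRDiscrete Q] [T2Space Q]
  [LocallyCompactSpace Q] [Group G] [TopologicalSpace G] [DiscreteTopology G]
  (c : ContinuousGroupoidHom Q G)

/-- The restriction of functions on `Q` to the kernel. -/
def restriction : ConvolutionAlgebra Q →ₗ[ℂ] ConvolutionAlgebra c.ker where
  toFun f := .mk (fun n => f n.1) (f.continuous.comp continuous_subtype_val)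
    (f.hasCompactSupport.comp_isClosedEmbedding c.isClopen_ker.isClosed.isClosedEmbedding_subtypeVal)
  map_add' _ _ := rfl
  map_smul' _ _ := rfl

theorem restriction_apply (f : ConvolutionAlgebra Q) (n : c.ker) : c.restriction f n = f n.1 := rfl

theorem inclusion_apply_of_notMem (f : ConvolutionAlgebra c.ker) {q : Q} (hq : q ∉ c.ker) :
    c.inclusion f q = 0 := c.extendZero_of_notMem f hq

theorem restriction_inclusion (f : ConvolutionAlgebra c.ker) :
    c.restriction (c.inclusion f) = f := ext fun n => c.extendZero_coe f n

theorem inclusion_restriction {f : ConvolutionAlgebra Q} (hf : ∀ q, f q ≠ 0 → q ∈ c.ker) :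
    c.inclusion (c.restriction f) = f := ext fun q => by
  by_cases hq : q ∈ c.ker
  · exact c.extendZero_coe _ ⟨q, hq⟩
  · rw [c.inclusion_apply_of_notMem _ hq]
    by_contra h
    exact hq (hf q (Ne.symm h))

theorem restriction_star (f : ConvolutionAlgebra Q) :
    c.restriction (star f) = star (c.restriction f) := rfl

/-- Split `x` into its part on the kernel and a part `x'` vanishing there. Since `c` is
multiplicative, multiplying `x'` by a function supported on the kernel keeps it off the kernel, so
only the first part survives restriction. -/
theorem restriction_mul_inclusion (x : ConvolutionAlgebra Q) (a : ConvolutionAlgebra c.ker) :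
    c.restriction (x * c.inclusion a) = c.restriction x * a := by
  set x' := x - c.inclusion (c.restriction x) with hx'
  have h : c.restriction (x' * c.inclusion a) = 0 := ext fun n => by
    refine conv_eq_zero fun y z hyz hy hz hm => ?_
    have hz' : c z = 1 := by
      by_contra h
      exact hz (c.inclusion_apply_of_notMem a h)
    have hy' : c y = 1 := by
      have h := c.map_mul' y z hyz
      rw [hm, hz', mul_one] at h
      exact h.symm.trans n.2
    refine hy ?_
    rw [hx', sub_eq_add_neg, ConvolutionAlgebra.add_apply, ConvolutionAlgebra.neg_apply]
    rw [show c.inclusion (c.restriction x) y = x y from c.extendZero_coe _ ⟨y, hy'⟩, add_neg_cancel]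
  have e : x = c.inclusion (c.restriction x) + x' := by rw [hx']; abel
  conv_lhs => rw [e]
  rw [add_mul, map_add, h, add_zero, ← map_mul, c.restriction_inclusion]

/-- Although `x⋆ x` is supported in the kernel, `x` need not be, so square roots must be found
inside the kernel. Write `x = ∑ Eᵢ Eᵢ⋆ x` with `Eᵢ` of the same degree `g`; then `Eᵢ⋆ x` has degree
`g⁻¹ g = e`. -/
theorem restriction_star_mul_self_mem_of_homogeneous {x : ConvolutionAlgebra Q} {g : G}
    (hx : ∀ q, x q ≠ 0 → c q = g) : c.restriction (star x * x) ∈ sumsOfSquares _ := by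
  have hcl : IsClopen (c ⁻¹' {g}) := (isClopen_discrete {g}).preimage c.continuous_toFun
  obtain ⟨n, E, hE, hs⟩ := exists_sum_mul_star_mul x hcl.isOpen
    (closure_minimal (fun q hq => hx q hq) hcl.isClosed)
  have h1 : ∀ i, ∃ h, star (E i) * x = c.inclusion h := fun i =>
    ⟨_, (c.inclusion_restriction fun q hq => by
      by_contra hq'
      refine hq (conv_eq_zero fun y z hyz hy hz hm => hq' ?_)
      have h2 : c (inv y) = g := hE i _ fun h0 => hy (by rw [star_apply, h0, map_zero])
      change c q = 1
      rw [← hm, c.map_mul', hx z hz, ← h2, c.map_inv, mul_inv_cancel]).symm⟩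
  choose h hh using h1
  have e : star x * x = c.inclusion (∑ i, star (h i) * h i) := by
    -- Only the right factor is expanded: `x⋆ Eᵢ Eᵢ⋆ x` is then the square of `Eᵢ⋆ x`.
    conv_lhs => enter [2]; rw [← hs]
    rw [Finset.mul_sum, map_sum]
    refine Finset.sum_congr rfl fun i _ => ?_
    rw [map_mul, map_star, ← hh, star_mul, star_star, mul_assoc]
  rw [e, c.restriction_inclusion]
  exact sum_mem fun i _ => star_mul_self_mem_sumsOfSquares _

open Classical in
/-- The component of `x` supported in `c⁻¹(g)`. -/
def component (g : G) (x : ConvolutionAlgebra Q) : ConvolutionAlgebra Q :=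
  .mk (Set.indicator (c ⁻¹' {g}) x)
    (((isClopen_discrete {g}).preimage c.continuous_toFun).continuous_indicator x.continuous)
    (x.hasCompactSupport.mono fun q hq h => hq (by rw [Set.indicator_apply, h, ite_self]))

/-- Compactness of the support and discreteness of `G` leave finitely many homogeneous components.
The product of the adjoint of one of degree `g` with one of degree `g'` has degree `g⁻¹ g'`, so
restriction retains only the diagonal terms. -/
theorem restriction_star_mul_self_mem (x : ConvolutionAlgebra Q) :
    c.restriction (star x * x) ∈ sumsOfSquares _ := by
  classical
  have hfin : (c '' tsupport x).Finite :=
    isCompact_iff_finite.1 (x.hasCompactSupport.isCompact.image c.continuous_toFun)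
  have hc : ∀ g q, c.component g x q ≠ 0 → c q = g := fun g q hq => by
    by_contra h
    exact hq (Set.indicator_of_notMem (s := c ⁻¹' {g}) h _)
  have hsum : x = ∑ g ∈ hfin.toFinset, c.component g x := ext fun q => by
    have : ∀ g, c.component g x q = if g = c q then x q else 0 := fun g => by
      rw [component, ConvolutionAlgebra.mk_apply, Set.indicator_apply]
      exact if_congr eq_comm rfl rfl
    simp only [ConvolutionAlgebra.sum_apply, this]
    rw [Finset.sum_ite_eq']
    split_ifs with h
    · rfl
    · by_contra h0
      exact h (hfin.mem_toFinset.2 ⟨q, subset_tsupport x h0, rfl⟩)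
  have e : c.restriction (star x * x) =
      ∑ g ∈ hfin.toFinset, c.restriction (star (c.component g x) * c.component g x) := by
    conv_lhs => rw [hsum]
    rw [star_sum, Finset.sum_mul, map_sum]
    refine Finset.sum_congr rfl fun g hg => ?_
    rw [Finset.mul_sum, map_sum]
    refine Finset.sum_eq_single g (fun g' _ hne => ?_) fun h => absurd hg h
    refine ext fun n => conv_eq_zero fun y z hyz hy hz hm => hne ?_
    have h2 : c (inv y) = g := hc g _ fun h0 => hy (by rw [star_apply, h0, map_zero])
    have h3 : c (mul y z hyz) = 1 := hm ▸ n.2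
    rw [c.map_mul', hc g' z hz] at h3
    rw [← h2, c.map_inv]
    exact (inv_eq_of_mul_eq_one_right h3).symm
  rw [e]
  exact sum_mem fun g _ => c.restriction_star_mul_self_mem_of_homogeneous (hc g)

/-- Restriction to the kernel as a positive retraction of the inclusion. -/
def expectation : AlgebraicExpectation c.inclusion where
  toLinearMap := c.restriction
  map_mul_map := c.restriction_mul_inclusion
  map_star' := c.restriction_star
  map_map := c.restriction_inclusion
  map_star_mul_self_mem := c.restriction_star_mul_self_mem

/-! ### Comparison of the C⋆-norms -/

/-- By subadditivity it is enough to treat `a` supported where the range map is injective. There `M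
x⋆ x - (a x)⋆ (a x)` is a square, its restriction is a sum of squares, and monotonicity of `p` gives
the bound `√M`. -/
theorem moduleSeminorm_mul_le (p : CStarSeminorm (ConvolutionAlgebra c.ker))
    (a : ConvolutionAlgebra Q) : ∃ C : ℝ, 0 ≤ C ∧ ∀ x,
      c.expectation.moduleSeminorm p (a * x) ≤ C * c.expectation.moduleSeminorm p x := by
  obtain ⟨n, F, rfl, hF⟩ := exists_sum_eq a
  have key : ∀ i, ∃ C : ℝ, 0 ≤ C ∧ ∀ x, c.expectation.moduleSeminorm p (F i * x) ≤
      C * c.expectation.moduleSeminorm p x := fun i => by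
    obtain ⟨e, he, hs⟩ := hF i
    obtain ⟨M, hM, h⟩ := exists_star_mul_self_add (a := F i) fun x hx y hy h =>
      e.injOn (hs hx) (hs hy) (by rw [he, he, h])
    refine ⟨√M, Real.sqrt_nonneg M, fun x => ?_⟩
    obtain ⟨y, hy⟩ := h x
    rw [AlgebraicExpectation.moduleSeminorm_apply, AlgebraicExpectation.moduleSeminorm_apply,
      ← Real.sqrt_mul hM]
    refine Real.sqrt_le_sqrt ?_
    have h1 := p.le_of_sub_mem_sumsOfSquares
      (c.restriction_star_mul_self_mem (F i * x)) (b := c.restriction ((M : ℂ) • (star x * x))) (by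
        rw [← hy, map_add, add_sub_cancel_right]
        exact c.restriction_star_mul_self_mem y)
    rw [map_smul, map_smul_eq_mul, Complex.norm_real, Real.norm_of_nonneg hM] at h1
    exact h1
  choose C hC0 hC using key
  refine ⟨∑ i, C i, Finset.sum_nonneg fun i _ => hC0 i, fun x => ?_⟩
  rw [Finset.sum_mul, Finset.sum_mul]
  exact (Finset.le_sum_of_subadditive _ (map_zero _).le (map_add_le_add _) Finset.univ _).trans
    (Finset.sum_le_sum fun i _ => hC i x)

/-- The inclusion of `C_c(N)` in `C_c(Q)` does not decrease the largest C⋆-seminorms. -/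
theorem largestCStarSeminorm_le (a : ConvolutionAlgebra c.ker) :
    largestCStarSeminorm (ConvolutionAlgebra c.ker) a ≤
      largestCStarSeminorm (ConvolutionAlgebra Q) (c.inclusion a) := by
  set p := largestCStarSeminorm (ConvolutionAlgebra c.ker) with hp
  obtain ⟨q, hq⟩ := c.expectation.exists_cstarSeminorm p (c.moduleSeminorm_mul_le p)
  obtain ⟨f, haf, hf⟩ := exists_mul_eq_self a
  -- The algebra need not have a unit, so the operator seminorm is tested on the right unit `f` of
  -- `a`: `p a = n(a f) ≤ q(a) p(f) ≤ q(a)`.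
  have h := hq (c.inclusion a) (c.inclusion f)
  rw [← map_mul, haf, AlgebraicExpectation.moduleSeminorm_map,
    AlgebraicExpectation.moduleSeminorm_map] at h
  exact (h.trans (mul_le_of_le_one_right (q.nonneg _) (hf p))).trans (le_largestCStarSeminorm _ q _)

/-- Both sides are continuous in `x`, so the inequality need only be checked on the dense image of
`C_c(N)`, where it compares the two largest C⋆-seminorms. -/
theorem norm_le_norm_canonicalMap (x : GroupoidCStarAlgebra c.ker) : ‖x‖ ≤ ‖c.canonicalMap x‖ := by
  refine UniformSpace.Completion.induction_on x (isClosed_le continuous_norm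
    (continuous_norm.comp UniformSpace.Completion.continuous_extension)) fun a => ?_
  have h1 := c.canonicalMap_of a
  exact ((CStarSeminorm.norm_toCompletion _ _).trans_le (c.largestCStarSeminorm_le a)).trans_eq
    ((CStarSeminorm.norm_toCompletion _ _).symm.trans (congrArg norm h1.symm))

end ContinuousGroupoidHom

end

theorem mainTheorem7 {Q : Type*} [TopologicalSpace Q] [TopologicalGroupoid Q] [IsRDiscrete Q]
    [T2Space Q] [LocallyCompactSpace Q] [SecondCountableTopology Q]
    {G : Type*} [Group G] [TopologicalSpace G] [DiscreteTopology G]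
    (c : ContinuousGroupoidHom Q G) :
    Function.Injective (c.canonicalMap :
      GroupoidCStarAlgebra c.ker → GroupoidCStarAlgebra Q) := by
  refine (injective_iff_map_eq_zero c.canonicalMap).2 fun x hx => ?_
  have h := c.norm_le_norm_canonicalMap x
  rw [hx, norm_zero] at h
  exact norm_le_zero_iff.1 h
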